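/- Let $G$ be a topological group whose underlying topological space is homeomorphic to a product $K\times M$ with $K$ compact and $M$ metrizable. Let $T_G$ be the site whose underlying category is the category of $G$-spaces (topological spaces with a continuous left $G$-action) and continuous $G$-equivariant maps, in which a family $\{\pi_i:X_i\to X\}$ is a covering if it admits local sections: every $x\in X$ has an open neighbourhood $V$ for which there are an index $i$ and a continuous (not necessarily equivariant) map $s:V\to X_i$ with $\pi_i s=\mathrm{id}_V$. Let $\mathbb R$ carry the trivial $G$-action, let $\widetilde{\mathbb R}$ be the sheaf $X\mapsto \mathrm{Map}_G(X,\mathbb R)$ of continuous $G$-equivariant maps on $T_G$, and put $H^p(G,\widetilde{\mathbb R})=H^p(T_G,*,\widetilde{\mathbb R})$, where $*$ is the one-point $G$-space. Let $C^p(G,\mathbb R)=\mathrm{Map}_G(G^{p+1},\mathbb R)$, where $G$ acts diagonally on $G^{p+1}$ by left translation, with $$(\delta f)(g_0,\dots,g_{p+1})=\sum_{i=0}^{p+1}(-1)^i f(g_0,\dots,\widehat{g_i},\dots,g_{p+1}),$$ be the complex of homogeneous continuous cochains; it is the Čech complex of the covering $\{G\to *\}$ with coefficients in $\widetilde{\mathbb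 R}$, and $H^p_c(G,\mathbb R)$ denotes its cohomology. Then for every $p\ge 0$ the canonical map $H^p_c(G,\mathbb R)\to H^p(G,\widetilde{\mathbb R})$ from Čech cohomology to sheaf cohomology is an isomorphism of groups. Here the canonical map is normalized as follows: in degree $0$ it sends the restriction to $G$ of a global section to that section, and, for a short exact sequence of abelian sheaves $0\to F\to E\to Q\to 0$ on $T_G$ with connecting homomorphism $\partial$ and a Čech $p$-cochain $b$ of $E$ whose coboundary is the image of a cochain $c$ of $F$, it sends the class of $c$ to $\partial y$, where $y\in H^p(T_G,*,Q)$ is the image of the class of the cocycle that $b$ induces in $Q$. -/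

import Mathlib

open CategoryTheory Opposite

universe u

/-! ### `G`-spaces -/

/-- A `G`-space: a topological space with a (jointly) continuous left action of `G`. -/
structure GSpace (G : Type u) [Group G] [TopologicalSpace G] : Type (u + 1) where
  carrier : Type u
  [topologicalSpace : TopologicalSpace carrier]
  [mulAction : MulAction G carrier]
  [continuousSMul : ContinuousSMul G carrier]

namespace GSpace

variable {G : Type u} [Group G] [TopologicalSpace G]

instance : CoeSort (GSpace G) (Type u) := ⟨GSpace.carrier⟩

instance (X : GSpace G) : TopologicalSpace X := X.topologicalSpace
instance (X : GSpace G) : MulAction G X := X.mulAction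
instance (X : GSpace G) : ContinuousSMul G X := X.continuousSMul

/-- Morphisms of `G`-spaces: continuous `G`-equivariant maps. -/
@[ext]
structure Hom (X Y : GSpace G) : Type u where
  toFun : X → Y
  continuous_toFun : Continuous toFun
  map_smul : ∀ (g : G) (x : X), toFun (g • x) = g • toFun x

instance (X Y : GSpace G) : CoeFun (Hom X Y) (fun _ => X → Y) := ⟨Hom.toFun⟩

instance : Category (GSpace G) where
  Hom X Y := Hom X Y
  id X := ⟨fun x => x, continuous_id, fun _ _ => rfl⟩
  comp f h := ⟨fun x => h.toFun (f.toFun x), h.continuous_toFun.comp f.continuous_toFun,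
    fun g x => by rw [f.map_smul, h.map_smul]⟩

/-- The underlying function of a morphism of `G`-spaces. -/
abbrev fn {X Y : GSpace G} (f : X ⟶ Y) : X → Y := Hom.toFun f

theorem continuous_fn {X Y : GSpace G} (f : X ⟶ Y) : Continuous (fn f) := f.continuous_toFun

theorem fn_smul {X Y : GSpace G} (f : X ⟶ Y) (g : G) (x : X) : fn f (g • x) = g • fn f x :=
  f.map_smul g x

@[ext]
theorem hom_ext {X Y : GSpace G} {f h : X ⟶ Y} (H : ∀ x, fn f x = fn h x) : f = h :=
  Hom.ext (funext H)

@[simp]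
theorem fn_comp {X Y Z : GSpace G} (f : X ⟶ Y) (h : Y ⟶ Z) (x : X) :
    fn (f ≫ h) x = fn h (fn f x) := rfl

@[simp]
theorem fn_id {X : GSpace G} (x : X) : fn (𝟙 X) x = x := rfl

variable (G) in
/-- The one-point space with trivial action. -/
def point : GSpace G where
  carrier := PUnit.{u + 1}
  mulAction := { smul := fun _ x => x, one_smul := fun _ => rfl, mul_smul := fun _ _ _ => rfl }
  continuousSMul := ⟨continuous_snd⟩

/-- The unique morphism to the point. -/
def toPoint (X : GSpace G) : X ⟶ point G :=
  ⟨fun _ => PUnit.unit, continuous_const, fun _ _ => rfl⟩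

variable (G) in
/-- The point is a terminal object of the category of `G`-spaces. -/
def pointIsTerminal : Limits.IsTerminal (point G) :=
  Limits.IsTerminal.ofUniqueHom toPoint (fun _ _ => hom_ext (fun _ => rfl))

/-- The diagonal action of `G` on the fibre product `X ×_Z Y`. -/
instance fiberProdMulAction {X Y Z : GSpace G} (f : X ⟶ Z) (h : Y ⟶ Z) :
    MulAction G {p : X × Y // fn f p.1 = fn h p.2} where
  smul g p := ⟨g • p.1, by simp only [Prod.smul_fst, Prod.smul_snd, fn_smul, p.2]⟩
  one_smul p := Subtype.ext (one_smul G p.1)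
  mul_smul g k p := Subtype.ext (mul_smul g k p.1)

/-- The fibre product `X ×_Z Y` of `G`-spaces, with the subspace topology and diagonal action. -/
def fiberProd {X Y Z : GSpace G} (f : X ⟶ Z) (h : Y ⟶ Z) : GSpace G where
  carrier := {p : X × Y // fn f p.1 = fn h p.2}
  continuousSMul := ⟨Continuous.subtype_mk
    (continuous_fst.smul (continuous_subtype_val.comp continuous_snd)) _⟩

/-- First projection from the fibre product. -/
def fiberProdFst {X Y Z : GSpace G} (f : X ⟶ Z) (h : Y ⟶ Z) : fiberProd f h ⟶ X :=
  ⟨fun p => p.1.1, continuous_fst.comp continuous_subtype_val, fun _ _ => rfl⟩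

/-- Second projection from the fibre product. -/
def fiberProdSnd {X Y Z : GSpace G} (f : X ⟶ Z) (h : Y ⟶ Z) : fiberProd f h ⟶ Y :=
  ⟨fun p => p.1.2, continuous_snd.comp continuous_subtype_val, fun _ _ => rfl⟩

/-! ### The local-section topology -/

/-- A sieve on `X` admits local sections if every `x : X` has an open neighbourhood `V` on which
some member `f : Y ⟶ X` of the sieve has a continuous section `V → Y` (not required to be
equivariant). -/
def AdmitsLocalSections {X : GSpace G} (S : Sieve X) : Prop :=
  ∀ x : X, ∃ (V : Set X) (Y : GSpace G) (f : Y ⟶ X) (s : C(V, Y)),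
    IsOpen V ∧ x ∈ V ∧ S f ∧ ∀ v : V, fn f (s v) = v

variable (G) in
/-- The local-section topology on the category of `G`-spaces. A sieve is covering exactly when it
contains a family `{π_i : X_i ⟶ X}` admitting local sections. -/
def localSectionTopology : GrothendieckTopology (GSpace G) where
  sieves X := {S | AdmitsLocalSections S}
  top_mem' X := fun x =>
    ⟨Set.univ, X, 𝟙 X, ⟨Subtype.val, continuous_subtype_val⟩, isOpen_univ, trivial, trivial,
      fun _ => rfl⟩
  pullback_stable' := by
    intro X X' S h hS x'
    obtain ⟨V, Y, f, s, hV, hx, hf, hs⟩ := hS (fn h x')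
    refine ⟨fn h ⁻¹' V, fiberProd f h, fiberProdSnd f h,
      ⟨fun v => ⟨(s ⟨fn h v.1, v.2⟩, v.1), hs _⟩, ?_⟩,
      hV.preimage (continuous_fn h), hx, ?_, fun v => rfl⟩
    · refine Continuous.subtype_mk (Continuous.prodMk (s.continuous.comp ?_)
        continuous_subtype_val) _
      exact Continuous.subtype_mk ((continuous_fn h).comp continuous_subtype_val) _
    · change S (fiberProdSnd f h ≫ h)
      have : fiberProdSnd f h ≫ h = fiberProdFst f h ≫ f := hom_ext (fun p => p.2.symm)
      rw [this]
      exact S.downward_closed hf _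
  transitive' := by
    intro X S hS R hR x
    obtain ⟨V, Y, f, s, hV, hx, hf, hs⟩ := hS x
    obtain ⟨W, Z, k, t, hW, hy, hk, ht⟩ := hR hf (s ⟨x, hx⟩)
    obtain ⟨U, hU, hUW⟩ := isOpen_induced_iff.mp (hW.preimage s.continuous)
    have key : ∀ v : (V ∩ U : Set X), s ⟨v.1, v.2.1⟩ ∈ W := fun v => by
      have : (⟨v.1, v.2.1⟩ : V) ∈ Subtype.val ⁻¹' U := v.2.2
      rw [hUW] at this
      exact this
    refine ⟨V ∩ U, Z, k ≫ f, ⟨fun v => t ⟨s ⟨v.1, v.2.1⟩, key v⟩, ?_⟩, hV.inter hU, ⟨hx, ?_⟩,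
      hk, fun v => ?_⟩
    · refine t.continuous.comp (Continuous.subtype_mk (s.continuous.comp ?_) _)
      exact Continuous.subtype_mk continuous_subtype_val _
    · have : (⟨x, hx⟩ : V) ∈ Subtype.val ⁻¹' U := by
        rw [hUW]; exact hy
      exact this
    · change fn f (fn k (t ⟨s ⟨v.1, v.2.1⟩, key v⟩)) = v
      rw [ht]
      exact hs _

/-! ### The sheaf of equivariant continuous real functions -/

/-- `Map_G(X, ℝ)` for the trivial action of `G` on `ℝ`: the group of continuous functions
`f : X → ℝ` with `f (g • x) = f x`. -/
def realMaps (X : GSpace G) : AddSubgroup C(X, ℝ) where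
  carrier := {f | ∀ (g : G) (x : X), f (g • x) = f x}
  zero_mem' := fun _ _ => rfl
  add_mem' := fun ha hb g x => by
    rw [ContinuousMap.add_apply, ContinuousMap.add_apply, ha g x, hb g x]
  neg_mem' := fun ha g x => by
    rw [ContinuousMap.neg_apply, ContinuousMap.neg_apply, ha g x]

/-- Pullback of invariant functions along a morphism of `G`-spaces. -/
def realMapsComp {X Y : GSpace G} (h : X ⟶ Y) : realMaps Y →+ realMaps X where
  toFun f := ⟨f.1.comp ⟨fn h, continuous_fn h⟩, fun g x => by
    change f.1 (fn h (g • x)) = f.1 (fn h x)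
    rw [fn_smul]
    exact f.2 g _⟩
  map_zero' := rfl
  map_add' _ _ := rfl

@[simp]
theorem realMapsComp_apply {X Y : GSpace G} (h : X ⟶ Y) (f : realMaps Y) (x : X) :
    (realMapsComp h f).1 x = f.1 (fn h x) := rfl

variable (G) in
/-- The presheaf `X ↦ Map_G(X, ℝ)` on the category of `G`-spaces. (The category of `G`-spaces is
large, so the values are lifted one universe up.) -/
def realPresheaf : (GSpace G)ᵒᵖ ⥤ AddCommGrpCat.{u + 1} where
  obj X := AddCommGrpCat.of (ULift.{u + 1} (realMaps X.unop))
  map h := AddCommGrpCat.ofHom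
    ((AddEquiv.ulift.symm.toAddMonoidHom.comp (realMapsComp h.unop)).comp
      AddEquiv.ulift.toAddMonoidHom)
  map_id _ := rfl
  map_comp _ _ := rfl

@[simp]
theorem realPresheaf_map_down_apply {X Y : GSpace G} (h : X ⟶ Y)
    (f : (realPresheaf G).obj (op Y)) (x : X) :
    ((realPresheaf G).map h.op f).down.1 x = f.down.1 (fn h x) := rfl

end GSpace

namespace GSpace

variable {G : Type u} [Group G] [TopologicalSpace G] [IsTopologicalGroup G]

variable (G) in
/-- The `G`-space `G^{n+1}` with diagonal action by left translation. -/
def power (n : ℕ) : GSpace G where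
  carrier := Fin (n + 1) → G

/-- The `i`-th face map `G^{n+2} → G^{n+1}`, `(g_0, …, g_{n+1}) ↦ (g_0, …, ĝ_i, …, g_{n+1})`. -/
def face {n : ℕ} (i : Fin (n + 2)) : power G (n + 1) ⟶ power G n :=
  ⟨fun x j => x (i.succAbove j), continuous_pi fun _ => continuous_apply _, fun _ _ => rfl⟩

/-- The orbit map `G → X`, `g ↦ g • x`. -/
def orbitMap (X : GSpace G) (x : X) : power G 0 ⟶ X :=
  ⟨fun g => g 0 • x, (continuous_apply (0 : Fin 1)).smul continuous_const,
    fun g k => mul_smul g (k 0) x⟩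

variable (G) in
theorem realPresheaf_isSheaf : Presheaf.IsSheaf (localSectionTopology G) (realPresheaf G) := by
  rw [Presheaf.isSheaf_iff_isSheaf_forget (s := forget AddCommGrpCat.{u + 1}),
    isSheaf_iff_isSheaf_of_type]
  intro X S hS x hx
  have compat : ∀ {Y Y' : GSpace G} (f : Y ⟶ X) (f' : Y' ⟶ X) (hf : S f) (hf' : S f')
      (y : Y) (y' : Y'), fn f y = fn f' y' → (x f hf).down.1 y = (x f' hf').down.1 y' := by
    intro Y Y' f f' hf hf' y y' e
    have h1 : orbitMap Y y ≫ f = orbitMap Y' y' ≫ f' := hom_ext fun g => by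
      change fn f (g 0 • y) = fn f' (g 0 • y')
      rw [fn_smul, fn_smul, e]
    have h2 := hx (orbitMap Y y) (orbitMap Y' y') hf hf' h1
    have h3 := congrArg (fun z : (realPresheaf G).obj (op (power G 0)) => z.down.1 (fun _ => 1)) h2
    change (x f hf).down.1 ((1 : G) • y) = (x f' hf').down.1 ((1 : G) • y') at h3
    rwa [one_smul, one_smul] at h3
  choose V Y f s hV hxV hf hs using hS
  let φ : X → ℝ := fun p => (x (f p) (hf p)).down.1 (s p ⟨p, hxV p⟩)
  have hφ : ∀ {Y' : GSpace G} (f' : Y' ⟶ X) (hf' : S f') (y : Y'),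
      φ (fn f' y) = (x f' hf').down.1 y := fun f' hf' y =>
    compat _ _ _ _ _ _ (hs _ _)
  have hcont : Continuous φ := by
    rw [continuous_iff_continuousAt]
    intro p
    have : ContinuousOn φ (V p) := by
      rw [continuousOn_iff_continuous_domRestrict]
      have : (V p).domRestrict φ = fun v => (x (f p) (hf p)).down.1 (s p v) := by
        funext v
        change φ v = _
        rw [← hφ (f p) (hf p), hs]
      rw [this]
      exact (x (f p) (hf p)).down.1.continuous.comp (s p).continuous
    exact this.continuousAt ((hV p).mem_nhds (hxV p))
  have hinv : ∀ (g : G) (p : X), φ (g • p) = φ p := by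
    intro g p
    have e1 := hφ (f p) (hf p) (g • s p ⟨p, hxV p⟩)
    rw [fn_smul, hs, (x (f p) (hf p)).down.2] at e1
    exact e1
  refine ⟨ULift.up ⟨⟨φ, hcont⟩, hinv⟩, ?_, ?_⟩
  · intro Y' f' hf'
    refine ULift.ext _ _ (Subtype.ext (ContinuousMap.ext fun y => ?_))
    exact hφ f' hf' y
  · intro t ht
    refine ULift.ext _ _ (Subtype.ext (ContinuousMap.ext fun p => ?_))
    have h1 := congrArg (fun z : (realPresheaf G).obj (op (Y p)) => z.down.1 (s p ⟨p, hxV p⟩))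
      (ht (f p) (hf p))
    change t.down.1 (fn (f p) (s p ⟨p, hxV p⟩)) = φ p at h1
    rw [hs] at h1
    exact h1

variable (G) in
/-- The sheaf `ℝ̃ : X ↦ Map_G(X, ℝ)` on the local-section site. -/
def realSheaf : Sheaf (localSectionTopology G) AddCommGrpCat.{u + 1} :=
  ⟨realPresheaf G, realPresheaf_isSheaf G⟩

/-! ### Sheaf cohomology on the local-section site -/

instance : IsGrothendieckAbelian.{u + 1}
    (Sheaf (localSectionTopology G) AddCommGrpCat.{u + 1}) := by
  have : EssentiallySmall.{u + 1} (GSpace G) := inferInstance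
  exact Sheaf.isGrothendieckAbelian_of_essentiallySmall _ _

/-- The cohomology groups of abelian sheaves on the local-section site exist (in the universe of
the coefficients). -/
instance : HasExt.{u + 1} (Sheaf (localSectionTopology G) AddCommGrpCat.{u + 1}) :=
  hasExt_of_enoughInjectives _

/-! ### Homogeneous continuous cochains -/

variable (G) in
/-- The group `C^n(G, ℝ) = Map_G(G^{n+1}, ℝ)` of homogeneous continuous cochains. -/
abbrev HomogeneousCochain (n : ℕ) : Type u := realMaps (power G n)

/-- The coboundary `(δ f)(g_0, …, g_{n+1}) = ∑ i, (-1)^i f(g_0, …, ĝ_i, …, g_{n+1})`. -/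
def homogeneousD (n : ℕ) : HomogeneousCochain G n →+ HomogeneousCochain G (n + 1) :=
  ∑ i : Fin (n + 2), (-1 : ℤ) ^ (i : ℕ) • realMapsComp (face i)

theorem homogeneousD_apply (n : ℕ) (f : HomogeneousCochain G n) (x : Fin (n + 2) → G) :
    (homogeneousD n f).1 x =
      ∑ i : Fin (n + 2), (-1 : ℝ) ^ (i : ℕ) * f.1 (fun j => x (i.succAbove j)) := by
  let ev : HomogeneousCochain G (n + 1) →+ ℝ :=
    { toFun := fun f => f.1 x, map_zero' := rfl, map_add' := fun _ _ => rfl }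
  change ev (homogeneousD n f) = _
  rw [homogeneousD, AddMonoidHom.finsetSum_apply, map_sum]
  refine Finset.sum_congr rfl fun i _ => ?_
  rw [AddMonoidHom.smul_apply, map_zsmul, zsmul_eq_mul]
  push_cast
  rfl

variable (G) in
/-- Homogeneous continuous cocycles. -/
def homogeneousCocycles (n : ℕ) : AddSubgroup (HomogeneousCochain G n) := (homogeneousD n).ker

variable (G) in
/-- Homogeneous continuous coboundaries. -/
def homogeneousCoboundaries : (n : ℕ) → AddSubgroup (HomogeneousCochain G n)
  | 0 => ⊥
  | n + 1 => (homogeneousD n).range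

variable (G) in
/-- The continuous (homogeneous) cochain cohomology `H^n_c(G, ℝ)`: cocycles modulo coboundaries. -/
abbrev ContCohomology (n : ℕ) : Type u :=
  homogeneousCocycles G n ⧸
    (homogeneousCoboundaries G n).addSubgroupOf (homogeneousCocycles G n)

/-! ### The canonical comparison with sheaf cohomology -/

/-- The coboundary `∑ i, (-1)^i F(face i) : F(G^{n+1}) → F(G^{n+2})` of the Čech complex of the
covering `{G ⟶ point}` with coefficients in a presheaf `F`. -/
def cechD (F : (GSpace G)ᵒᵖ ⥤ AddCommGrpCat.{u + 1}) (n : ℕ) :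
    F.obj (op (power G n)) →+ F.obj (op (power G (n + 1))) :=
  ∑ i : Fin (n + 2), (-1 : ℤ) ^ (i : ℕ) • (F.map (face i).op).hom

/-- Homogeneous `n`-cochains are the Čech `n`-cochains of the sheaf `ℝ̃`. -/
def toCechCochain (n : ℕ) :
    HomogeneousCochain G n ≃+ (realSheaf G).obj.obj (op (power G n)) :=
  AddEquiv.ulift.symm

theorem map_toCechCochain {m n : ℕ} (k : power G n ⟶ power G m) (f : HomogeneousCochain G m) :
    ((realSheaf G).obj.map k.op).hom (toCechCochain m f) =
      toCechCochain n (realMapsComp k f) := rfl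

theorem cechD_toCechCochain (n : ℕ) (f : HomogeneousCochain G n) :
    cechD (realSheaf G).obj n (toCechCochain n f) = toCechCochain (n + 1) (homogeneousD n f) := by
  rw [cechD, homogeneousD, AddMonoidHom.finsetSum_apply, AddMonoidHom.finsetSum_apply, map_sum]
  refine Finset.sum_congr rfl fun i _ => ?_
  rw [AddMonoidHom.smul_apply, AddMonoidHom.smul_apply, map_zsmul, map_toCechCochain]

/-- The graph of the canonical map from the Čech cocycles of the covering `{G ⟶ point}` to the
cohomology of the sheaf `F` over the point. In degree `0`, a section over `G` represents the
global section of which it is the restriction. In degree `n + 1`, a cochain `c` represents `∂ y`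
if, for some short exact sequence of sheaves `0 → F → E → Q → 0` with connecting homomorphism `∂`,
there is a cochain `b` of `E` whose coboundary is the image of `c` and whose image in `Q`
represents `y`. -/
def Represents : (n : ℕ) → (F : Sheaf (localSectionTopology G) AddCommGrpCat.{u + 1}) →
    F.obj.obj (op (power G n)) → F.H n → Prop
  | 0, F, c, x =>
    (F.obj.map (toPoint (power G 0)).op).hom (Sheaf.H.equiv₀ F (pointIsTerminal G) x) = c
  | n + 1, F, c, x =>
    ∃ (E Q : Sheaf (localSectionTopology G) AddCommGrpCat.{u + 1}) (i : F ⟶ E) (q : E ⟶ Q)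
      (w : i ≫ q = 0) (hS : (ShortComplex.mk i q w).ShortExact)
      (b : E.obj.obj (op (power G n))) (y : Q.H n),
      cechD E.obj n b = (i.hom.app (op (power G (n + 1)))).hom c ∧
      Represents n Q ((q.hom.app (op (power G n))).hom b) y ∧
      x = Abelian.Ext.comp y hS.extClass rfl

end GSpace

/-!
Write `ℤ[X]` for the free abelian sheaf on an object `X`, so that `Hom(ℤ[X], F) = F(X)`.

**The comparison map.** Let `N` be the Čech nerve of a covering of the terminal object. At the level
of presheaves the complex `ℤ[N₀] ← ℤ[N₁] ← ⋯` is exact in positive degrees: over an object `T` it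
is a direct sum, over the maps `T ⟶ X`, of the chain complexes of simplices on the set of lifts, and
such a complex is contracted by prepending a fixed lift (`CechNerve.exact_freePresheaf`). After
sheafification it becomes a resolution of `ℤ`. With `Kₙ` the cokernel of `ℤ[Nₙ₊₁] ⟶ ℤ[Nₙ]`, the short
exact sequences `0 ⟶ Kₙ₊₁ ⟶ ℤ[Nₙ] ⟶ Kₙ ⟶ 0` and the isomorphism `K₀ ≅ ℤ` splice to a class in
`Extⁿ(ℤ, Kₙ)`. A Čech cocycle is a morphism `Kₙ ⟶ F`, and the canonical map sends it to its
composition with that class (`CechNerve.comparison`). By naturality of extension classes this is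
compatible with connecting homomorphisms, without a sign (`CechNerve.comparison_succ`), and so it is
the function whose graph is `Represents` (`GSpace.represents_iff`). If the sheaf has no higher
cohomology on any of the `Nₙ`, the long exact `Ext` sequences show that the map is surjective with
kernel the coboundaries.

**Vanishing on powers of `G`.** The `G`-space `G^{n+1}` is isomorphic to `G × Y`, with `Y = Gⁿ` not
acted upon. A covering of `G × Y` is refined by the sets `G × U` for an open cover `U` of `Y`. The
hypothesis on `G` makes `Gⁿ` paracompact (compact times metrizable), hence normal since topological
groups are `R₁`, so that this cover is refined by a closed cover carrying a subordinate partition of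
unity `ρ`. Closed covers are used rather than open ones because all terms of their Čech nerves are
again of the form `G × Z` with `Z` paracompact. The homotopy `f ↦ ∑ⱼ ρⱼ f(j, –)` shows that the
Čech cohomology of `ℝ̃` vanishes for such nerves (`GSpace.realSheaf_isCechAcyclic`), and Cartan's
criterion (`ext_eq_zero_of_cartan`), proved by shifting dimensions along an embedding into an
injective sheaf, yields the vanishing of the sheaf cohomology.
-/

open Abelian

/-! ### Free abelian sheaves -/

lemma isSheafFor_of_generate_mem {C : Type (u + 1)} [LargeCategory.{u} C]
    {J : GrothendieckTopology C} (F : Sheaf J AddCommGrpCat.{u + 1}) {X : C} {R : Presieve X}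
    (hR : Sieve.generate R ∈ J X) : R.IsSheafFor (F.obj ⋙ forget AddCommGrpCat.{u + 1}) := by
  rw [Presieve.isSheafFor_iff_generate]
  have h : Presieve.IsSheaf J (F.obj ⋙ forget AddCommGrpCat.{u + 1}) := by
    rw [← isSheaf_iff_isSheaf_of_type, ← Presheaf.isSheaf_iff_isSheaf_forget]
    exact F.property
  exact h _ hR

lemma sections_eq_of_empty_cover {C : Type (u + 1)} [LargeCategory.{u} C]
    {J : GrothendieckTopology C} (F : Sheaf J AddCommGrpCat.{u + 1}) {X : C}
    (hX : Sieve.generate (⊥ : Presieve X) ∈ J X) (a b : F.obj.obj (op X)) : a = b :=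
  (isSheafFor_of_generate_mem F hX).isSeparatedFor.ext fun _ _ hf => hf.elim

section
variable {C : Type (u + 1)} [LargeCategory.{u} C] {J : GrothendieckTopology C} {X Y Z : C}

lemma presheaf_map_map (F : Cᵒᵖ ⥤ AddCommGrpCat.{u + 1}) (k : Y ⟶ X) (l : X ⟶ Z)
    (s : F.obj (op Z)) : (F.map k.op).hom ((F.map l.op).hom s) = (F.map (k ≫ l).op).hom s := by
  simp

lemma sheafHom_naturality {E Q : Sheaf J AddCommGrpCat.{u + 1}} (q : E ⟶ Q) (k : Y ⟶ X)
    (e : E.obj.obj (op X)) : (q.hom.app _).hom ((E.obj.map k.op).hom e) =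
      (Q.obj.map k.op).hom ((q.hom.app _).hom e) :=
  ConcreteCategory.congr_hom (q.hom.naturality k.op) e

end

section
variable {C : Type (u + 1)} [LargeCategory.{u} C] (J : GrothendieckTopology C)
  [HasSheafify J AddCommGrpCat.{u + 1}]

/-- The free abelian presheaf `T ↦ ℤ[Hom(T, X)]` on an object `X`. The category is large, so the
sets of morphisms are lifted one universe up. -/
noncomputable def freePresheaf : C ⥤ Cᵒᵖ ⥤ AddCommGrpCat.{u + 1} :=
  uliftYoneda.{u + 1} ⋙ (Functor.whiskeringRight _ _ _).obj AddCommGrpCat.free.{u + 1}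

/-- The free abelian sheaf `ℤ[X]` on an object `X`. -/
noncomputable def freeSheaf : C ⥤ Sheaf J AddCommGrpCat.{u + 1} :=
  freePresheaf ⋙ presheafToSheaf J AddCommGrpCat.{u + 1}

variable {J}
variable {X Y : C} {F E : Sheaf J AddCommGrpCat.{u + 1}}

variable (J) in
/-- The free abelian sheaf on a presheaf of sets is left adjoint to the forgetful functor. -/
noncomputable def freeSheafAdj :
    (Functor.whiskeringRight Cᵒᵖ _ _).obj AddCommGrpCat.free.{u + 1} ⋙
        presheafToSheaf J AddCommGrpCat.{u + 1} ⊣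
      sheafToPresheaf J AddCommGrpCat.{u + 1} ⋙
        (Functor.whiskeringRight Cᵒᵖ _ _).obj (forget AddCommGrpCat.{u + 1}) :=
  (AddCommGrpCat.adj.whiskerRight Cᵒᵖ).comp (sheafificationAdjunction J _)

/-- Morphisms out of the free abelian sheaf on `X` are sections over `X`; see `sec` for the additive
version. -/
noncomputable def freeSheafHomEquiv (X : C) (F : Sheaf J AddCommGrpCat.{u + 1}) :
    ((freeSheaf J).obj X ⟶ F) ≃ F.obj.obj (op X) :=
  ((freeSheafAdj J).homEquiv (uliftYoneda.{u + 1}.obj X) F).trans uliftYonedaEquiv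

lemma freeSheafHomEquiv_comp (f : (freeSheaf J).obj X ⟶ F) (g : F ⟶ E) :
    freeSheafHomEquiv X E (f ≫ g) = (g.hom.app (op X)).hom (freeSheafHomEquiv X F f) :=
  (congrArg uliftYonedaEquiv ((freeSheafAdj J).homEquiv_naturality_right f g)).trans
    (uliftYonedaEquiv_comp _ _)

lemma freeSheafHomEquiv_map (f : (freeSheaf J).obj X ⟶ F) (k : Y ⟶ X) :
    freeSheafHomEquiv Y F ((freeSheaf J).map k ≫ f) =
      (F.obj.map k.op).hom (freeSheafHomEquiv X F f) :=
  (congrArg uliftYonedaEquiv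
    ((freeSheafAdj J).homEquiv_naturality_left (uliftYoneda.{u + 1}.map k) f)).trans
    (uliftYonedaEquiv_naturality _ k.op).symm

/-- The group isomorphism `Hom(ℤ[X], F) ≃ F(X)`. It allows sections and morphisms to be used
interchangeably. -/
noncomputable def sec (X : C) (F : Sheaf J AddCommGrpCat.{u + 1}) :
    ((freeSheaf J).obj X ⟶ F) ≃+ F.obj.obj (op X) :=
  { freeSheafHomEquiv X F with
    map_add' := fun f g => by
      have h (k : (freeSheaf J).obj X ⟶ F) : freeSheafHomEquiv X F k =
          (k.hom.app (op X)).hom (freeSheafHomEquiv X _ (𝟙 _)) := by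
        rw [← freeSheafHomEquiv_comp, Category.id_comp]
      change freeSheafHomEquiv X F _ = freeSheafHomEquiv X F _ + freeSheafHomEquiv X F _
      rw [h, h f, h g]
      rfl }

lemma sec_comp (f : (freeSheaf J).obj X ⟶ F) (g : F ⟶ E) :
    sec X E (f ≫ g) = (g.hom.app (op X)).hom (sec X F f) := freeSheafHomEquiv_comp f g

lemma sec_map (f : (freeSheaf J).obj X ⟶ F) (k : Y ⟶ X) :
    sec Y F ((freeSheaf J).map k ≫ f) = (F.obj.map k.op).hom (sec X F f) :=
  freeSheafHomEquiv_map f k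

end

section
variable {C : Type*} [Category C] {A : Type*} [Category A] [Abelian A]

lemma exact_of_evaluation (S : ShortComplex (C ⥤ A))
    (h : ∀ X, (S.map ((evaluation C A).obj X)).Exact) : S.Exact := by
  rw [ShortComplex.exact_iff_isZero_homology]
  refine Functor.isZero _ fun X => ?_
  exact ((ShortComplex.exact_iff_isZero_homology _).1 (h X)).of_iso
    (S.mapHomologyIso ((evaluation C A).obj X)).symm
end

section
variable {C : Type (u + 1)} [LargeCategory.{u} C]

/-- A Čech nerve of a morphism `aug : obj 0 ⟶ X`: the object `obj n` is an `(n + 1)`-fold fibre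
power of `obj 0` over `X`, with projections `proj n i`, and `face n i` omits the `i`-th factor. The
fibre powers are data because in the applications they have convenient concrete models. -/
structure CechNerve (X : C) where
  obj : ℕ → C
  aug : obj 0 ⟶ X
  proj (n : ℕ) (i : Fin (n + 1)) : obj n ⟶ obj 0
  face (n : ℕ) (i : Fin (n + 2)) : obj (n + 1) ⟶ obj n
  proj_zero : proj 0 0 = 𝟙 (obj 0)
  proj_aug (n : ℕ) (i j : Fin (n + 1)) : proj n i ≫ aug = proj n j ≫ aug
  face_proj (n : ℕ) (i : Fin (n + 2)) (j : Fin (n + 1)) :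
    face n i ≫ proj n j = proj (n + 1) (i.succAbove j)
  exists_lift {T : C} (n : ℕ) (t : Fin (n + 1) → (T ⟶ obj 0))
    (ht : ∀ i j, t i ≫ aug = t j ≫ aug) : ∃ l : T ⟶ obj n, ∀ i, l ≫ proj n i = t i
  hom_ext {T : C} {n : ℕ} {f g : T ⟶ obj n} (h : ∀ i, f ≫ proj n i = g ≫ proj n i) : f = g

namespace CechNerve
variable {X : C} (N : CechNerve X)

/-- The morphism to a fibre power with given components. -/
noncomputable def lift {T : C} {n : ℕ} (t : Fin (n + 1) → (T ⟶ N.obj 0))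
    (ht : ∀ i j, t i ≫ N.aug = t j ≫ N.aug) : T ⟶ N.obj n := (N.exists_lift n t ht).choose

@[simp]
lemma lift_proj {T : C} {n : ℕ} (t : Fin (n + 1) → (T ⟶ N.obj 0))
    (ht : ∀ i j, t i ≫ N.aug = t j ≫ N.aug) (i : Fin (n + 1)) :
    N.lift t ht ≫ N.proj n i = t i := (N.exists_lift n t ht).choose_spec i

/-- The simplicial object formed by the fibre powers. -/
noncomputable def simplicialObject : SimplicialObject C where
  obj Δ := N.obj Δ.unop.len
  map f := N.lift (fun i => N.proj _ (f.unop.toOrderHom i)) (fun _ _ => N.proj_aug _ _ _)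
  map_id Δ := N.hom_ext fun i => by simp
  map_comp f g := N.hom_ext fun i => by simp

lemma simplicialObject_δ (n : ℕ) (i : Fin (n + 2)) : N.simplicialObject.δ i = N.face n i :=
  N.hom_ext fun j => by
    exact (N.lift_proj (T := N.obj (n + 1)) (n := n) _
      (fun _ _ => N.proj_aug _ _ _) j).trans (N.face_proj n i j).symm

section
variable {D : Type*} [Category D] [Preadditive D] (P : C ⥤ D)

/-- The alternating sum of the face maps, after applying a functor to a preadditive category. -/
def boundary (n : ℕ) : P.obj (N.obj (n + 1)) ⟶ P.obj (N.obj n) :=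
  ∑ i : Fin (n + 2), (-1 : ℤ) ^ (i : ℕ) • P.map (N.face n i)

lemma boundary_comp_boundary (n : ℕ) : N.boundary P (n + 1) ≫ N.boundary P n = 0 := by
  have h (m : ℕ) : N.boundary P m = AlgebraicTopology.AlternatingFaceMapComplex.objD
      (((SimplicialObject.whiskering C D).obj P).obj N.simplicialObject) m := by
    refine Finset.sum_congr rfl fun i _ => ?_
    rw [← N.simplicialObject_δ]
    rfl
  rw [h, h]
  exact AlgebraicTopology.AlternatingFaceMapComplex.d_squared _ n
end
end CechNerve
end

/-! ### Čech cohomology of injective sheaves -/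

namespace CechNerve
section
variable {C : Type (u + 1)} [LargeCategory.{u} C] {X : C} (N : CechNerve X)

/-- A lift of `f : T ⟶ X` to `obj 0` that depends only on `f`. -/
noncomputable def chosenLift {T : C} (f : T ⟶ X) (hf : ∃ s : T ⟶ N.obj 0, s ≫ N.aug = f) :
    T ⟶ N.obj 0 := hf.choose

lemma chosenLift_aug {T : C} (f : T ⟶ X) (hf : ∃ s : T ⟶ N.obj 0, s ≫ N.aug = f) :
    N.chosenLift f hf ≫ N.aug = f := hf.choose_spec

lemma cons_chosenLift_aug {T : C} {n : ℕ} (t : T ⟶ N.obj n) (i : Fin (n + 2)) :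
    (Fin.cons (α := fun _ => T ⟶ N.obj 0)
      (N.chosenLift (t ≫ N.proj n 0 ≫ N.aug) ⟨t ≫ N.proj n 0, Category.assoc _ _ _⟩)
      (fun i => t ≫ N.proj n i) i) ≫ N.aug = t ≫ N.proj n 0 ≫ N.aug := by
  cases i using Fin.cases with
  | zero => exact N.chosenLift_aug _ _
  | succ i => rw [Fin.cons_succ, Category.assoc, N.proj_aug n i 0]

/-- The point `(s, t₀, …, tₙ)` of `obj (n + 1)`, where `s` is the chosen lift of the image in `X` of
`t = (t₀, …, tₙ)`. As `s` depends only on that image, prepending commutes with the faces that keep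
`s`. -/
noncomputable def prepend {T : C} {n : ℕ} (t : T ⟶ N.obj n) : T ⟶ N.obj (n + 1) :=
  N.lift (Fin.cons
    (N.chosenLift (t ≫ N.proj n 0 ≫ N.aug) ⟨t ≫ N.proj n 0, Category.assoc _ _ _⟩)
    fun i => t ≫ N.proj n i)
    fun i j => (N.cons_chosenLift_aug t i).trans (N.cons_chosenLift_aug t j).symm

lemma prepend_face_zero {T : C} {n : ℕ} (t : T ⟶ N.obj n) :
    N.prepend t ≫ N.face n 0 = t := by
  refine N.hom_ext fun i => ?_
  rw [Category.assoc, face_proj, prepend, lift_proj]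
  rfl

lemma prepend_face_succ {T : C} {n : ℕ} (t : T ⟶ N.obj (n + 1)) (i : Fin (n + 2)) :
    N.prepend t ≫ N.face (n + 1) i.succ = N.prepend (t ≫ N.face n i) := by
  refine N.hom_ext fun j => ?_
  rw [Category.assoc, face_proj, prepend, lift_proj, prepend, lift_proj]
  cases j using Fin.cases with
  | zero =>
    have h : (t ≫ N.face n i) ≫ N.proj n 0 ≫ N.aug = t ≫ N.proj (n + 1) 0 ≫ N.aug := by
      rw [Category.assoc, ← Category.assoc (N.face n i), face_proj, N.proj_aug (n + 1) _ 0]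
    simp only [Fin.succ_succAbove_zero, Fin.cons_zero, h]
  | succ j =>
    simp only [Fin.succ_succAbove_succ, Fin.cons_succ, Category.assoc, face_proj]

lemma boundary_freePresheaf_of (T : C) (n : ℕ) (t : T ⟶ N.obj (n + 1)) :
    ((N.boundary freePresheaf n).app (op T)).hom (FreeAbelianGroup.of (ULift.up t)) =
      ∑ i : Fin (n + 2), (-1 : ℤ) ^ (i : ℕ) •
        FreeAbelianGroup.of (ULift.up.{u + 1} (t ≫ N.face n i)) := by
  let ev : (freePresheaf.obj (N.obj (n + 1)) ⟶ freePresheaf.obj (N.obj n)) →+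
      FreeAbelianGroup (ULift.{u + 1} (T ⟶ N.obj n)) :=
    { toFun := fun f => (f.app (op T)).hom (FreeAbelianGroup.of (ULift.up t))
      map_zero' := rfl
      map_add' := fun _ _ => rfl }
  refine (map_sum ev _ _).trans (Finset.sum_congr rfl fun i _ => ?_)
  rw [map_zsmul]
  exact congrArg (_ • ·) (FreeAbelianGroup.map_of_apply _)

/-- The free presheaf complex of a Čech nerve is exact in positive degrees, because prepending the
chosen lift is a contracting homotopy. No covering hypothesis is needed: over a map `T ⟶ X` without
lifts the complex is zero in nonnegative degrees. -/
lemma exact_freePresheaf (n : ℕ) :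
    (ShortComplex.mk _ _ (N.boundary_comp_boundary freePresheaf n)).Exact := by
  refine exact_of_evaluation _ fun T => ?_
  obtain ⟨T⟩ := T
  rw [ShortComplex.ab_exact_iff]
  intro x hx
  let h (m : ℕ) : FreeAbelianGroup (ULift.{u + 1} (T ⟶ N.obj m)) →+
      FreeAbelianGroup (ULift.{u + 1} (T ⟶ N.obj (m + 1))) :=
    FreeAbelianGroup.map fun t => ULift.up (N.prepend t.down)
  let d (m : ℕ) : FreeAbelianGroup (ULift.{u + 1} (T ⟶ N.obj (m + 1))) →+
      FreeAbelianGroup (ULift.{u + 1} (T ⟶ N.obj m)) :=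
    ((N.boundary freePresheaf m).app (op T)).hom
  have hd (m : ℕ) (t : T ⟶ N.obj (m + 1)) : d m (FreeAbelianGroup.of (ULift.up t)) =
      ∑ i : Fin (m + 2), (-1 : ℤ) ^ (i : ℕ) • FreeAbelianGroup.of (ULift.up (t ≫ N.face m i)) :=
    N.boundary_freePresheaf_of T m t
  have hh (m : ℕ) (t : T ⟶ N.obj m) : h m (FreeAbelianGroup.of (ULift.up t)) =
      FreeAbelianGroup.of (ULift.up (N.prepend t)) := FreeAbelianGroup.map_of_apply _
  have key : (d (n + 1)).comp (h (n + 1)) + (h n).comp (d n) = AddMonoidHom.id _ := by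
    refine FreeAbelianGroup.lift_ext _ _ fun t => ?_
    obtain ⟨t⟩ := t
    rw [AddMonoidHom.add_apply, AddMonoidHom.comp_apply, AddMonoidHom.comp_apply, hh, hd, hd,
      map_sum, Fin.sum_univ_succ, prepend_face_zero, add_assoc, ← Finset.sum_add_distrib,
      Finset.sum_eq_zero]
    · simp
    · intro i _
      rw [map_zsmul, hh, prepend_face_succ, Fin.val_succ, pow_succ]
      simp
  refine ⟨h (n + 1) x, ?_⟩
  have hx' : d n x = 0 := hx
  have e : d (n + 1) (h (n + 1) x) + h n (d n x) = x := DFunLike.congr_fun key x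
  rw [hx', map_zero, add_zero] at e
  exact e

/-- The Čech coboundary with coefficients in an abelian presheaf. -/
def coboundary (F : Cᵒᵖ ⥤ AddCommGrpCat.{u + 1}) (n : ℕ) :
    F.obj (op (N.obj n)) →+ F.obj (op (N.obj (n + 1))) :=
  ∑ i : Fin (n + 2), (-1 : ℤ) ^ (i : ℕ) • (F.map (N.face n i).op).hom

lemma coboundary_restrict (F : Cᵒᵖ ⥤ AddCommGrpCat.{u + 1}) (s : F.obj (op X)) :
    N.coboundary F 0 ((F.map N.aug.op).hom s) = 0 := by
  have : N.face 0 0 ≫ N.aug = N.face 0 1 ≫ N.aug := by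
    have h (i : Fin 2) : N.face 0 i ≫ N.aug = N.proj 1 0 ≫ N.aug := by
      have := N.face_proj 0 i 0
      rw [proj_zero, Category.comp_id] at this
      rw [this, N.proj_aug]
    rw [h, h]
  have e : (F.map (N.face 0 0).op).hom ((F.map N.aug.op).hom s) =
      (F.map (N.face 0 1).op).hom ((F.map N.aug.op).hom s) := by
    have := congrArg (fun k => (F.map k.op).hom s) this
    simpa using this
  rw [coboundary, Fin.sum_univ_two]
  simp [e]

/-- For a covering, the Čech `0`-cocycles are the restrictions of sections over the base. -/
lemma sheaf_glue {J : GrothendieckTopology C} {F : Sheaf J AddCommGrpCat.{u + 1}}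
    (hN : Sieve.generate (Presieve.singleton N.aug) ∈ J X)
    (c : F.obj.obj (op (N.obj 0))) (hc : N.coboundary F.obj 0 c = 0) :
    ∃! y : F.obj.obj (op X), (F.obj.map N.aug.op).hom y = c := by
  have h2 := isSheafFor_of_generate_mem F hN
  rw [Presieve.isSheafFor_singleton] at h2
  refine h2 c fun {T} p₁ p₂ hp => ?_
  let l := N.lift (n := 1) ![p₁, p₂] (by
    intro i j
    fin_cases i <;> fin_cases j <;> simp [hp])
  have e1 : l ≫ N.face 0 1 = p₁ := by
    have : N.face 0 1 = N.proj 1 0 := by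
      have := N.face_proj 0 1 0
      rwa [proj_zero, Category.comp_id] at this
    rw [this]
    exact N.lift_proj _ _ _
  have e0 : l ≫ N.face 0 0 = p₂ := by
    have : N.face 0 0 = N.proj 1 1 := by
      have := N.face_proj 0 0 0
      rwa [proj_zero, Category.comp_id] at this
    rw [this]
    exact N.lift_proj _ _ _
  have e : (F.obj.map (N.face 0 1).op).hom c = (F.obj.map (N.face 0 0).op).hom c := by
    rw [coboundary, Fin.sum_univ_two] at hc
    refine (sub_eq_zero.1 ?_).symm
    rw [← hc]
    simp [sub_eq_add_neg]
  have := congrArg (F.obj.map l.op).hom e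
  rw [← e1, ← e0]
  simpa using this

variable (J : GrothendieckTopology C)
  [HasSheafify J AddCommGrpCat.{u + 1}]

lemma exact_freeSheaf (n : ℕ) :
    (ShortComplex.mk _ _ (N.boundary_comp_boundary (freeSheaf J) n)).Exact := by
  have h := (N.exact_freePresheaf n).map (presheafToSheaf J AddCommGrpCat.{u + 1})
  have e (m : ℕ) : N.boundary (freeSheaf J) m =
      (presheafToSheaf J AddCommGrpCat.{u + 1}).map (N.boundary freePresheaf m) := by
    simp only [boundary, Functor.map_sum, Functor.map_zsmul]
    rfl
  have : ShortComplex.mk _ _ (N.boundary_comp_boundary (freeSheaf J) n) =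
    (ShortComplex.mk _ _ (N.boundary_comp_boundary freePresheaf n)).map
      (presheafToSheaf J AddCommGrpCat.{u + 1}) := by
    simp only [ShortComplex.map, ← e]
    rfl
  rw [this]
  exact h

variable {J} {F E : Sheaf J AddCommGrpCat.{u + 1}}

lemma coboundary_sec (n : ℕ) (f : (freeSheaf J).obj (N.obj n) ⟶ F) :
    N.coboundary F.obj n (sec _ _ f) = sec _ _ (N.boundary (freeSheaf J) n ≫ f) := by
  rw [boundary, Preadditive.sum_comp, map_sum, coboundary, AddMonoidHom.finsetSum_apply]
  refine Finset.sum_congr rfl fun i _ => ?_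
  rw [Preadditive.zsmul_comp, map_zsmul, sec_map, AddMonoidHom.smul_apply]

lemma coboundary_naturality (q : F ⟶ E) (n : ℕ) (c : F.obj.obj (op (N.obj n))) :
    N.coboundary E.obj n ((q.hom.app _).hom c) = (q.hom.app _).hom (N.coboundary F.obj n c) := by
  obtain ⟨f, rfl⟩ := (sec _ _).surjective c
  rw [← sec_comp, coboundary_sec, coboundary_sec, ← sec_comp, Category.assoc]

lemma coboundary_coboundary (n : ℕ) (c : F.obj.obj (op (N.obj n))) :
    N.coboundary F.obj (n + 1) (N.coboundary F.obj n c) = 0 := by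
  obtain ⟨f, rfl⟩ := (sec _ _).surjective c
  rw [coboundary_sec, coboundary_sec, ← Category.assoc, boundary_comp_boundary, Limits.zero_comp,
    map_zero]

/-- An injective sheaf has no Čech cohomology in positive degrees. -/
lemma exists_coboundary_eq_of_injective [Injective F] (n : ℕ)
    (c : F.obj.obj (op (N.obj (n + 1)))) (hc : N.coboundary F.obj (n + 1) c = 0) :
    ∃ b, N.coboundary F.obj n b = c := by
  obtain ⟨f, rfl⟩ := (sec _ _).surjective c
  rw [coboundary_sec, map_eq_zero_iff _ (sec _ _).injective] at hc
  refine ⟨sec _ _ ((N.exact_freeSheaf J n).descToInjective f hc), ?_⟩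
  rw [coboundary_sec]
  exact congrArg _ ((N.exact_freeSheaf J n).comp_descToInjective f hc)

end
end CechNerve

/-! ### Cartan's criterion for vanishing cohomology -/

section
variable {C : Type (u + 1)} [LargeCategory.{u} C] {J : GrothendieckTopology C}
  [HasSheafify J AddCommGrpCat.{u + 1}] {F E Q : Sheaf J AddCommGrpCat.{u + 1}}

lemma sections_comp_eq_zero {i : F ⟶ E} {q : E ⟶ Q} (w : i ≫ q = 0) {X : C}
    (a : F.obj.obj (op X)) : (q.hom.app (op X)).hom ((i.hom.app (op X)).hom a) = 0 := by
  obtain ⟨f, rfl⟩ := (sec X F).surjective a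
  rw [← sec_comp, ← sec_comp, Category.assoc, w, Limits.comp_zero, map_zero]

section
variable {i : F ⟶ E} {q : E ⟶ Q} {w : i ≫ q = 0} (hS : (ShortComplex.mk i q w).ShortExact)
include hS

lemma sections_injective_of_shortExact (X : C) : Function.Injective (i.hom.app (op X)).hom := by
  intro a b h
  obtain ⟨f, rfl⟩ := (sec X F).surjective a
  obtain ⟨g, rfl⟩ := (sec X F).surjective b
  rw [← sec_comp, ← sec_comp] at h
  have : Mono i := hS.mono_f
  rw [(cancel_mono i).1 ((sec X E).injective h)]

lemma exists_section_of_shortExact {X : C} (e : E.obj.obj (op X))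
    (he : (q.hom.app (op X)).hom e = 0) : ∃ a, (i.hom.app (op X)).hom a = e := by
  obtain ⟨f, rfl⟩ := (sec X E).surjective e
  rw [← sec_comp, map_eq_zero_iff _ (sec X Q).injective] at he
  have := hS.mono_f
  refine ⟨sec X F (hS.exact.lift f he), ?_⟩
  rw [← sec_comp]
  exact congrArg _ (hS.exact.lift_f f he)
end

namespace CechNerve
variable {X : C} (N : CechNerve X)

/-- The Čech cohomology of `F` vanishes in positive degrees for the nerve `N`. -/
def IsCechAcyclic (F : Sheaf J AddCommGrpCat.{u + 1}) : Prop :=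
  ∀ (n : ℕ) (c : F.obj.obj (op (N.obj (n + 1)))), N.coboundary F.obj (n + 1) c = 0 →
    ∃ b, N.coboundary F.obj n b = c

/-- If the Čech complexes form a short exact sequence, acyclicity passes to the quotient sheaf. -/
lemma isCechAcyclic_quotient {i : F ⟶ E} {q : E ⟶ Q} {w : i ≫ q = 0}
    (hS : (ShortComplex.mk i q w).ShortExact) (hF : N.IsCechAcyclic F) (hE : N.IsCechAcyclic E)
    (hq : ∀ n, Function.Surjective (q.hom.app (op (N.obj n))).hom) : N.IsCechAcyclic Q := by
  intro n c hc
  obtain ⟨e, rfl⟩ := hq _ c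
  rw [coboundary_naturality] at hc
  obtain ⟨a, ha⟩ := exists_section_of_shortExact hS _ hc
  obtain ⟨a', rfl⟩ := hF (n + 1) a (sections_injective_of_shortExact hS _ (by
    rw [← coboundary_naturality, ha, coboundary_coboundary, map_zero]))
  rw [← coboundary_naturality] at ha
  obtain ⟨b, hb⟩ := hE n (e - (i.hom.app _).hom a') (by rw [map_sub, ha, sub_self])
  refine ⟨(q.hom.app _).hom b, ?_⟩
  rw [coboundary_naturality, hb, map_sub]
  rw [sections_comp_eq_zero w, sub_zero]

/-- A section of the quotient that lifts after restriction to `obj 0` lifts over the base: two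
lifts differ by a Čech `1`-cocycle of the kernel, which is a coboundary. -/
lemma exists_lift_of_isCechAcyclic (hN : Sieve.generate (Presieve.singleton N.aug) ∈ J X)
    {i : F ⟶ E} {q : E ⟶ Q} {w : i ≫ q = 0}
    (hS : (ShortComplex.mk i q w).ShortExact) (hF : N.IsCechAcyclic F)
    (s : Q.obj.obj (op X)) (t : E.obj.obj (op (N.obj 0)))
    (ht : (q.hom.app _).hom t = (Q.obj.map N.aug.op).hom s) :
    ∃ e, (q.hom.app (op X)).hom e = s := by
  have h1 : N.coboundary Q.obj 0 ((Q.obj.map N.aug.op).hom s) = 0 :=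
    N.coboundary_restrict _ _
  obtain ⟨a, ha⟩ := exists_section_of_shortExact hS (N.coboundary E.obj 0 t) (by
    rw [← coboundary_naturality, ht, h1])
  obtain ⟨a', rfl⟩ := hF 0 a (sections_injective_of_shortExact hS _ (by
    rw [← coboundary_naturality, ha, coboundary_coboundary, map_zero]))
  rw [← coboundary_naturality] at ha
  obtain ⟨e, he, -⟩ := N.sheaf_glue hN (t - (i.hom.app _).hom a') (by rw [map_sub, ha, sub_self])
  refine ⟨e, (N.sheaf_glue hN _ h1).unique ?_ rfl⟩
  obtain ⟨f, rfl⟩ := (sec _ _).surjective e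
  rw [← sec_comp, ← sec_map]
  rw [← sec_map] at he
  rw [← Category.assoc, sec_comp, he, map_sub, ht]
  rw [sections_comp_eq_zero w, sub_zero]

end CechNerve

/-- **Cartan's criterion.** Suppose that a class `B` of objects and a class `Cov` of nerves of
coverings with all terms in `B` are such that sections over objects of `B` can be lifted along
epimorphisms after passing to a nerve in `Cov`. Then a sheaf that is Čech acyclic for all nerves in
`Cov` has no higher cohomology on the objects of `B`. -/
theorem ext_eq_zero_of_cartan [HasExt.{u + 1} (Sheaf J AddCommGrpCat.{u + 1})]
    [EnoughInjectives (Sheaf J AddCommGrpCat.{u + 1})]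
    {B : C → Prop} {Cov : ∀ ⦃X : C⦄, CechNerve X → Prop}
    (hJ : ∀ ⦃X⦄ (N : CechNerve X), Cov N → Sieve.generate (Presieve.singleton N.aug) ∈ J X)
    (hB : ∀ ⦃X⦄ (N : CechNerve X), Cov N → ∀ n, B (N.obj n))
    (hlift : ∀ ⦃X⦄, B X → ∀ {E Q : Sheaf J AddCommGrpCat.{u + 1}} (q : E ⟶ Q) [Epi q]
      (s : Q.obj.obj (op X)), ∃ N : CechNerve X, Cov N ∧ ∃ t : E.obj.obj (op (N.obj 0)),
        (q.hom.app _).hom t = (Q.obj.map N.aug.op).hom s)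
    (n : ℕ) : ∀ (F : Sheaf J AddCommGrpCat.{u + 1})
      (_ : ∀ ⦃X⦄ (N : CechNerve X), Cov N → N.IsCechAcyclic F) (X : C) (_ : B X)
      (x : Ext ((freeSheaf J).obj X) F (n + 1)), x = 0 := by
  induction n with
  | zero =>
    intro F hF X hX x
    let S := ShortComplex.mk _ _ (Limits.cokernel.condition (Injective.ι F))
    have hS : S.ShortExact := { exact := ShortComplex.exact_cokernel _ }
    obtain ⟨y, rfl⟩ := Ext.covariant_sequence_exact₁ _ hS x (Ext.eq_zero_of_injective _)
      (n₀ := 0) rfl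
    obtain ⟨y, rfl⟩ := Ext.mk₀_bijective _ _ |>.2 y
    obtain ⟨N, hN, t, ht⟩ := hlift hX S.g (sec _ _ y)
    obtain ⟨e, he⟩ := N.exists_lift_of_isCechAcyclic (hJ N hN) hS (hF N hN) _ t ht
    obtain ⟨f, rfl⟩ := (sec _ _).surjective e
    rw [← sec_comp] at he
    obtain rfl := (sec _ _).injective he
    rw [← Ext.mk₀_comp_mk₀, Ext.comp_assoc_of_second_deg_zero, hS.comp_extClass, Ext.comp_zero]
  | succ n ih =>
    intro F hF X hX x
    let S := ShortComplex.mk _ _ (Limits.cokernel.condition (Injective.ι F))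
    have hS : S.ShortExact := { exact := ShortComplex.exact_cokernel _ }
    obtain ⟨y, rfl⟩ := Ext.covariant_sequence_exact₁ _ hS x (Ext.eq_zero_of_injective _)
      (n₀ := n + 1) rfl
    rw [ih S.X₃ ?_ X hX y, Ext.zero_comp]
    intro X N hN
    refine N.isCechAcyclic_quotient hS (hF N hN) N.exists_coboundary_eq_of_injective fun n s => ?_
    obtain ⟨N', hN', t, ht⟩ := hlift (hB N hN n) S.g s
    exact N'.exists_lift_of_isCechAcyclic (hJ N' hN') hS (hF N' hN') _ t ht
end

/-! ### The comparison map by splicing the Čech resolution -/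

namespace CechNerve
section
variable {C : Type (u + 1)} [LargeCategory.{u} C] (J : GrothendieckTopology C)
  [HasSheafify J AddCommGrpCat.{u + 1}] {X : C} (N : CechNerve X)

/-- The cokernel `Kₙ` of `ℤ[obj (n + 1)] ⟶ ℤ[obj n]`; it represents Čech `n`-cocycles. -/
noncomputable def syzygy (n : ℕ) : Sheaf J AddCommGrpCat.{u + 1} :=
  Limits.cokernel (N.boundary (freeSheaf J) n)

/-- The projection `ℤ[obj n] ⟶ Kₙ`. -/
noncomputable def syzygyπ (n : ℕ) : (freeSheaf J).obj (N.obj n) ⟶ N.syzygy J n :=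
  Limits.cokernel.π _

instance (n : ℕ) : Epi (N.syzygyπ J n) := inferInstanceAs (Epi (Limits.cokernel.π _))

lemma boundary_syzygyπ (n : ℕ) : N.boundary (freeSheaf J) n ≫ N.syzygyπ J n = 0 :=
  Limits.cokernel.condition _

/-- The morphism `Kₙ₊₁ ⟶ ℤ[obj n]` induced by the boundary. -/
noncomputable def syzygyι (n : ℕ) : N.syzygy J (n + 1) ⟶ (freeSheaf J).obj (N.obj n) :=
  Limits.cokernel.desc _ (N.boundary (freeSheaf J) n) (N.boundary_comp_boundary (freeSheaf J) n)

lemma syzygyπ_syzygyι (n : ℕ) :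
    N.syzygyπ J (n + 1) ≫ N.syzygyι J n = N.boundary (freeSheaf J) n :=
  Limits.cokernel.π_desc _ _ _

lemma syzygyι_syzygyπ (n : ℕ) : N.syzygyι J n ≫ N.syzygyπ J n = 0 := by
  rw [← cancel_epi (N.syzygyπ J (n + 1)), ← Category.assoc, syzygyπ_syzygyι, Limits.comp_zero]
  exact N.boundary_syzygyπ J n

lemma syzygy_shortExact (n : ℕ) :
    (ShortComplex.mk _ _ (N.syzygyι_syzygyπ J n)).ShortExact where
  exact := by
    have h : (ShortComplex.mk (N.boundary (freeSheaf J) n) (N.syzygyπ J n)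
      (Limits.cokernel.condition _)).Exact := ShortComplex.exact_cokernel _
    let φ : ShortComplex.mk (N.boundary (freeSheaf J) n) (N.syzygyπ J n)
      (Limits.cokernel.condition _) ⟶ ShortComplex.mk _ _ (N.syzygyι_syzygyπ J n) :=
      { τ₁ := N.syzygyπ J (n + 1), τ₂ := 𝟙 _, τ₃ := 𝟙 _
        comm₁₂ := (N.syzygyπ_syzygyι J n).trans (Category.comp_id _).symm }
    have : Epi φ.τ₁ := inferInstanceAs (Epi (N.syzygyπ J (n + 1)))
    have : IsIso φ.τ₂ := inferInstanceAs (IsIso (𝟙 _))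
    have : Mono φ.τ₃ := inferInstanceAs (Mono (𝟙 _))
    exact (ShortComplex.exact_iff_of_epi_of_isIso_of_mono φ).1 h
  mono_f := (N.exact_freeSheaf J n).mono_cokernelDesc
  epi_g := inferInstanceAs (Epi (N.syzygyπ J n))

variable {J}
variable {F E Q : Sheaf J AddCommGrpCat.{u + 1}}

/-- The morphism `Kₙ ⟶ F` corresponding to a Čech cocycle. -/
noncomputable def cocycleHom {n : ℕ} (c : F.obj.obj (op (N.obj n)))
    (hc : N.coboundary F.obj n c = 0) : N.syzygy J n ⟶ F :=
  Limits.cokernel.desc _ ((sec _ _).symm c) ((sec _ _).injective (by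
    rw [← coboundary_sec, AddEquiv.apply_symm_apply, hc, map_zero]))

lemma π_cocycleHom {n : ℕ} (c : F.obj.obj (op (N.obj n)))
    (hc : N.coboundary F.obj n c = 0) :
    N.syzygyπ J n ≫ N.cocycleHom c hc = (sec _ _).symm c :=
  Limits.cokernel.π_desc _ _ _

lemma coboundary_sec_π {n : ℕ} (f : N.syzygy J n ⟶ F) :
    N.coboundary F.obj n (sec _ _ (N.syzygyπ J n ≫ f)) = 0 := by
  rw [coboundary_sec, ← Category.assoc, boundary_syzygyπ, Limits.zero_comp, map_zero]

lemma cocycleHom_sec_π {n : ℕ} (f : N.syzygy J n ⟶ F) :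
    N.cocycleHom _ (N.coboundary_sec_π f) = f := by
  rw [← cancel_epi (N.syzygyπ J n), π_cocycleHom, AddEquiv.symm_apply_apply]

/-- If `b` has coboundary in `F`, it induces a cocycle in the quotient. -/
lemma coboundary_image {i : F ⟶ E} {q : E ⟶ Q} (w : i ≫ q = 0) {n : ℕ}
    (c : F.obj.obj (op (N.obj (n + 1)))) (b : E.obj.obj (op (N.obj n)))
    (hb : N.coboundary E.obj n b = (i.hom.app _).hom c) :
    N.coboundary Q.obj n ((q.hom.app _).hom b) = 0 := by
  rw [coboundary_naturality, hb, sections_comp_eq_zero w]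

/-- The data required by `GSpace.Represents` in positive degree exist: embed `F` into an injective
sheaf, whose Čech cohomology vanishes. -/
lemma exists_shortExact_comparison [EnoughInjectives (Sheaf J AddCommGrpCat.{u + 1})] {n : ℕ}
    (c : F.obj.obj (op (N.obj (n + 1)))) (hc : N.coboundary F.obj (n + 1) c = 0) :
    ∃ (E Q : Sheaf J AddCommGrpCat.{u + 1}) (i : F ⟶ E) (q : E ⟶ Q) (w : i ≫ q = 0)
      (_ : (ShortComplex.mk i q w).ShortExact) (b : E.obj.obj (op (N.obj n))),
      N.coboundary E.obj n b = (i.hom.app _).hom c := by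
  obtain ⟨b, hb⟩ := N.exists_coboundary_eq_of_injective (F := Injective.under F) n
    (((Injective.ι F).hom.app _).hom c) (by rw [coboundary_naturality, hc, map_zero])
  exact ⟨_, _, _, _, Limits.cokernel.condition (Injective.ι F),
    { exact := ShortComplex.exact_cokernel _ }, b, hb⟩

end

section
variable {C : Type (u + 1)} [LargeCategory.{u} C] (J : GrothendieckTopology C)
  [HasSheafify J AddCommGrpCat.{u + 1}] [HasExt.{u + 1} (Sheaf J AddCommGrpCat.{u + 1})]
  {X : C} (hX : Limits.IsTerminal X) (N : CechNerve X)

/-- The constant sheaf `ℤ`, whose `Ext` groups define sheaf cohomology. -/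
noncomputable abbrev constZ : Sheaf J AddCommGrpCat.{u + 1} :=
  (constantSheaf J AddCommGrpCat.{u + 1}).obj (AddCommGrpCat.of (ULift ℤ))

/-- The restriction to `obj 0` of the global section `1` of the constant sheaf `ℤ`. -/
noncomputable def fundamentalCochain : (constZ J).obj.obj (op (N.obj 0)) :=
  ((constZ J).obj.map N.aug.op).hom (Sheaf.H.equiv₀ (constZ J) hX (Ext.mk₀ (𝟙 _)))

variable {J} in
lemma map_equiv₀_mk₀ {F : Sheaf J AddCommGrpCat.{u + 1}} (f : constZ J ⟶ F) :
    (F.obj.map N.aug.op).hom (Sheaf.H.equiv₀ F hX (Ext.mk₀ f)) =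
      (f.hom.app _).hom (N.fundamentalCochain J hX) := by
  have h := Sheaf.H.equiv₀_naturality hX f (Ext.mk₀ (𝟙 _))
  rw [Sheaf.H.map_apply, Ext.mk₀_comp_mk₀, Category.id_comp] at h
  rw [← h, fundamentalCochain]
  exact (ConcreteCategory.congr_hom (f.hom.naturality N.aug.op) _).symm

lemma coboundary_fundamentalCochain :
    N.coboundary (constZ J).obj 0 (N.fundamentalCochain J hX) = 0 :=
  N.coboundary_restrict _ _

/-- The morphism `K₀ ⟶ ℤ` given by the section `1`; it is an isomorphism for a covering of the
terminal object. -/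
noncomputable def syzygyAug : N.syzygy J 0 ⟶ constZ J :=
  N.cocycleHom (N.fundamentalCochain J hX) (N.coboundary_fundamentalCochain J hX)

variable {J} in
lemma sec_π_syzygyAug {F : Sheaf J AddCommGrpCat.{u + 1}} (f : constZ J ⟶ F) :
    sec _ _ (N.syzygyπ J 0 ≫ N.syzygyAug J hX ≫ f) =
      (f.hom.app _).hom (N.fundamentalCochain J hX) := by
  rw [syzygyAug, ← Category.assoc, π_cocycleHom, sec_comp, AddEquiv.apply_symm_apply]

variable (hN : Sieve.generate (Presieve.singleton N.aug) ∈ J X)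
include hN

/-- Both sheaves represent the global sections functor, by the sheaf condition. -/
lemma isIso_syzygyAug : IsIso (N.syzygyAug J hX) := by
  refine isIso_of_coyoneda_map_bijective _ fun F => ⟨fun f g h => ?_, fun f => ?_⟩
  · have h' : (f.hom.app _).hom (N.fundamentalCochain J hX) =
        (g.hom.app _).hom (N.fundamentalCochain J hX) := by
      have := congrArg (fun k => sec _ _ (N.syzygyπ J 0 ≫ k)) h
      simpa only [sec_π_syzygyAug] using this
    rw [← map_equiv₀_mk₀, ← map_equiv₀_mk₀] at h'
    have := (N.sheaf_glue hN _ (N.coboundary_restrict _ _)).unique h' rfl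
    exact (Ext.mk₀_bijective _ _).1 ((Sheaf.H.equiv₀ F hX).injective this)
  · obtain ⟨y, hy, -⟩ := N.sheaf_glue hN _ (N.coboundary_sec_π f)
    obtain ⟨y, rfl⟩ := (Sheaf.H.equiv₀ F hX).surjective y
    obtain ⟨g, rfl⟩ := (Ext.mk₀_bijective _ _).2 y
    refine ⟨g, ?_⟩
    rw [map_equiv₀_mk₀] at hy
    dsimp only
    rw [← cancel_epi (N.syzygyπ J 0), ← (sec _ _).injective.eq_iff, ← hy, sec_π_syzygyAug]

/-- The class in `Extⁿ(ℤ, Kₙ)` obtained by splicing the sequences `0 ⟶ Kₘ₊₁ ⟶ ℤ[obj m] ⟶ Kₘ ⟶ 0` for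
`m < n` with the isomorphism `ℤ ≅ K₀`. -/
noncomputable def syzygyClass : (n : ℕ) → Ext (constZ J) (N.syzygy J n) n
  | 0 => Ext.mk₀ (have := N.isIso_syzygyAug J hX hN; inv (N.syzygyAug J hX))
  | n + 1 => (syzygyClass n).comp (N.syzygy_shortExact J n).extClass rfl

variable {J}
variable {F E Q : Sheaf J AddCommGrpCat.{u + 1}}

/-- The canonical map from Čech cocycles to sheaf cohomology. -/
noncomputable def comparison {n : ℕ} (c : F.obj.obj (op (N.obj n)))
    (hc : N.coboundary F.obj n c = 0) : F.H n :=
  (N.syzygyClass J hX hN n).comp (Ext.mk₀ (N.cocycleHom c hc)) (add_zero n)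

lemma comparison_zero_iff (c : F.obj.obj (op (N.obj 0)))
    (hc : N.coboundary F.obj 0 c = 0) (x : F.H 0) :
    N.comparison hX hN c hc = x ↔ (F.obj.map N.aug.op).hom (Sheaf.H.equiv₀ F hX x) = c := by
  have := N.isIso_syzygyAug J hX hN
  obtain ⟨g, rfl⟩ := (Ext.mk₀_bijective _ _).2 x
  rw [map_equiv₀_mk₀, comparison, syzygyClass, Ext.mk₀_comp_mk₀, (Ext.mk₀_bijective _ _).1.eq_iff,
    IsIso.inv_comp_eq, ← cancel_epi (N.syzygyπ J 0), π_cocycleHom, AddEquiv.symm_apply_eq,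
    sec_π_syzygyAug, eq_comm]

/-- The canonical map commutes with connecting homomorphisms: the cochains `c`, `b` and the image of
`b` form a morphism from the sequence `0 ⟶ Kₙ₊₁ ⟶ ℤ[obj n] ⟶ Kₙ ⟶ 0` to the given one. -/
lemma comparison_succ {i : F ⟶ E} {q : E ⟶ Q} {w : i ≫ q = 0}
    (hS : (ShortComplex.mk i q w).ShortExact) {n : ℕ} (c : F.obj.obj (op (N.obj (n + 1))))
    (hc : N.coboundary F.obj (n + 1) c = 0) (b : E.obj.obj (op (N.obj n)))
    (hb : N.coboundary E.obj n b = (i.hom.app _).hom c)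
    (hqb : N.coboundary Q.obj n ((q.hom.app _).hom b) = 0) :
    N.comparison hX hN c hc =
      Ext.comp (N.comparison hX hN ((q.hom.app _).hom b) hqb) hS.extClass rfl := by
  let φ : ShortComplex.mk _ _ (N.syzygyι_syzygyπ J n) ⟶ ShortComplex.mk i q w :=
    { τ₁ := N.cocycleHom c hc
      τ₂ := (sec _ _).symm b
      τ₃ := N.cocycleHom _ hqb
      comm₁₂ := by
        dsimp
        rw [← cancel_epi (N.syzygyπ J (n + 1)), ← Category.assoc, ← Category.assoc,
          π_cocycleHom, syzygyπ_syzygyι, ← (sec _ _).injective.eq_iff, sec_comp, ← coboundary_sec, AddEquiv.apply_symm_apply,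
          AddEquiv.apply_symm_apply, hb]
      comm₂₃ := by
        dsimp
        rw [π_cocycleHom, ← (sec _ _).injective.eq_iff, sec_comp, AddEquiv.apply_symm_apply,
          AddEquiv.apply_symm_apply] }
  have h := ShortComplex.ShortExact.extClass_naturality (N.syzygy_shortExact J n) hS φ
  rw [comparison, syzygyClass, Ext.comp_assoc_of_third_deg_zero]
  erw [h]
  rw [comparison]
  exact (Ext.comp_assoc_of_second_deg_zero _ _ _ _).symm

lemma comparison_add {n : ℕ} (c c' : F.obj.obj (op (N.obj n)))
    (hc : N.coboundary F.obj n c = 0) (hc' : N.coboundary F.obj n c' = 0)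
    (hcc' : N.coboundary F.obj n (c + c') = 0) :
    N.comparison hX hN (c + c') hcc' = N.comparison hX hN c hc + N.comparison hX hN c' hc' := by
  have : N.cocycleHom (c + c') hcc' = N.cocycleHom c hc + N.cocycleHom c' hc' := by
    rw [← cancel_epi (N.syzygyπ J n), Preadditive.comp_add, π_cocycleHom, π_cocycleHom,
      π_cocycleHom, map_add]
  rw [comparison, this, Ext.mk₀_add, Ext.comp_add]
  rfl

section
variable (hF : ∀ (n m : ℕ) (x : Ext ((freeSheaf J).obj (N.obj n)) F (m + 1)), x = 0)
include hF

/-- Dimension shifting along the resolution, in positive degrees, for a sheaf without higher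
cohomology on the terms of the nerve. -/
lemma syzygyClass_comp_bijective (n : ℕ) : ∀ (m k : ℕ) (h : n + (m + 1) = k),
    Function.Bijective fun x : Ext (N.syzygy J n) F (m + 1) =>
      (N.syzygyClass J hX hN n).comp x h := by
  induction n with
  | zero =>
    intro m k h
    have := N.isIso_syzygyAug J hX hN
    obtain rfl : m + 1 = k := by lia
    refine Function.bijective_iff_has_inverse.2
      ⟨fun x => (Ext.mk₀ (N.syzygyAug J hX)).comp x (zero_add _), fun x => ?_, fun x => ?_⟩
    · dsimp only [syzygyClass]
      rw [Ext.mk₀_comp_mk₀_assoc, IsIso.hom_inv_id, Ext.mk₀_id_comp]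
    · dsimp only [syzygyClass]
      rw [Ext.mk₀_comp_mk₀_assoc, IsIso.inv_hom_id, Ext.mk₀_id_comp]
  | succ n ih =>
    intro m k h
    have hS := N.syzygy_shortExact J n
    have e (x : Ext (N.syzygy J (n + 1)) F (m + 1)) :
        (N.syzygyClass J hX hN (n + 1)).comp x h =
          (N.syzygyClass J hX hN n).comp (hS.extClass.comp x (show 1 + (m + 1) = m + 2 by lia))
            (by lia) := by
      rw [syzygyClass, Ext.comp_assoc]
      lia
    have hb : Function.Bijective fun x : Ext (N.syzygy J (n + 1)) F (m + 1) =>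
        hS.extClass.comp x (show 1 + (m + 1) = m + 2 by lia) := by
      refine ⟨fun x y hxy => sub_eq_zero.1 ?_, fun x => ?_⟩
      · obtain ⟨z, hz⟩ := Ext.contravariant_sequence_exact₁ hS F (x - y)
          (n₁ := m + 2) (by lia) (by
            dsimp only at hxy
            rw [sub_eq_add_neg, Ext.comp_add, Ext.comp_neg, hxy, add_neg_cancel])
        rw [← hz, hF n m z, Ext.comp_zero]
      · exact Ext.contravariant_sequence_exact₃ hS F x (hF n (m + 1) _) (by lia)
    simp only [e]
    exact (ih (m + 1) k (by lia)).comp hb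

lemma comparison_surjective (n : ℕ) (x : F.H n) :
    ∃ c, ∃ hc : N.coboundary F.obj n c = 0, N.comparison hX hN c hc = x := by
  suffices ∃ f : N.syzygy J n ⟶ F, (N.syzygyClass J hX hN n).comp (Ext.mk₀ f) (add_zero n) = x by
    obtain ⟨f, hf⟩ := this
    refine ⟨_, N.coboundary_sec_π f, ?_⟩
    rw [comparison, cocycleHom_sec_π]
    exact hf
  cases n with
  | zero =>
    have := N.isIso_syzygyAug J hX hN
    obtain ⟨g, rfl⟩ := (Ext.mk₀_bijective _ _).2 x
    refine ⟨N.syzygyAug J hX ≫ g, ?_⟩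
    rw [syzygyClass, Ext.mk₀_comp_mk₀, IsIso.inv_hom_id_assoc]
  | succ n =>
    obtain ⟨y, rfl⟩ := (N.syzygyClass_comp_bijective hX hN hF n 0 _ rfl).2 x
    obtain ⟨z, rfl⟩ := Ext.contravariant_sequence_exact₃ (N.syzygy_shortExact J n) F y
      (hF n 0 _) (n₀ := 0) rfl
    obtain ⟨f, rfl⟩ := (Ext.mk₀_bijective _ _).2 z
    refine ⟨f, ?_⟩
    rw [syzygyClass, Ext.comp_assoc_of_third_deg_zero]

lemma exists_coboundary_of_comparison_eq_zero (n : ℕ) (c : F.obj.obj (op (N.obj (n + 1))))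
    (hc : N.coboundary F.obj (n + 1) c = 0) (h : N.comparison hX hN c hc = 0) :
    ∃ b, N.coboundary F.obj n b = c := by
  have hS := N.syzygy_shortExact J n
  rw [comparison, syzygyClass, Ext.comp_assoc_of_third_deg_zero] at h
  have h' := (N.syzygyClass_comp_bijective hX hN hF n 0 _ rfl).1
    (h.trans (Ext.comp_zero _ _ _ _ _).symm)
  obtain ⟨z, hz⟩ := Ext.contravariant_sequence_exact₁ hS F _ _ h'
  obtain ⟨f, rfl⟩ := (Ext.mk₀_bijective _ _).2 z
  rw [Ext.mk₀_comp_mk₀] at hz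
  have hz' : N.syzygyι J n ≫ f = N.cocycleHom c hc := (Ext.mk₀_bijective _ _).1 hz
  refine ⟨sec _ _ f, ?_⟩
  rw [coboundary_sec, ← syzygyπ_syzygyι, Category.assoc, hz', π_cocycleHom,
    AddEquiv.apply_symm_apply]

end

lemma comparison_coboundary (n : ℕ) (b : F.obj.obj (op (N.obj n))) :
    N.comparison hX hN (N.coboundary F.obj n b) (N.coboundary_coboundary n b) = 0 := by
  have : N.cocycleHom _ (N.coboundary_coboundary n b) = N.syzygyι J n ≫ (sec _ _).symm b := by
    rw [← cancel_epi (N.syzygyπ J (n + 1)), π_cocycleHom, ← Category.assoc, syzygyπ_syzygyι,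
      AddEquiv.symm_apply_eq, ← coboundary_sec, AddEquiv.apply_symm_apply]
  rw [comparison, this, ← Ext.mk₀_comp_mk₀, syzygyClass, Ext.comp_assoc_of_third_deg_zero]
  exact (congrArg (fun z => (N.syzygyClass J hX hN n).comp z rfl)
    ((N.syzygy_shortExact J n).extClass_comp_assoc _)).trans (Ext.comp_zero _ _ _ _ _)

end
end CechNerve

/-! ### The covering of the point by `G` -/

namespace GSpace
variable {G : Type u} [Group G] [TopologicalSpace G] [IsTopologicalGroup G]

variable (G) in
/-- The powers of `G` form the Čech nerve of `G ⟶ point`. -/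
noncomputable def powerNerve : CechNerve (point G) where
  obj := power G
  aug := toPoint _
  proj _ i := ⟨fun x _ => x i, continuous_pi fun _ => continuous_apply i, fun _ _ => rfl⟩
  face _ i := face i
  proj_zero := hom_ext fun x => funext fun j => congrArg x (Subsingleton.elim (0 : Fin 1) j)
  proj_aug _ _ _ := rfl
  face_proj _ _ _ := rfl
  exists_lift _ t _ := ⟨⟨fun x i => fn (t i) x 0,
    continuous_pi fun i => (continuous_apply (0 : Fin 1)).comp (continuous_fn (t i)),
    fun g x => funext fun i => congrFun (fn_smul (t i) g x) 0⟩,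
    fun i => hom_ext fun x => funext fun j => congrArg (fn (t i) x) (Subsingleton.elim (0 : Fin 1) j)⟩
  hom_ext h := hom_ext fun x => funext fun i => congrFun (congrArg (fun k => fn k x) (h i)) 0

lemma powerNerve_covering :
    Sieve.generate (Presieve.singleton (powerNerve G).aug) ∈ localSectionTopology G (point G) :=
  fun _ => ⟨Set.univ, power G 0, toPoint _, ⟨fun _ _ => 1, continuous_const⟩, isOpen_univ, trivial,
    ⟨_, 𝟙 _, _, Presieve.singleton_self _, Category.id_comp _⟩, fun _ => rfl⟩

/-- The canonical map for the covering `G ⟶ point`. -/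
noncomputable abbrev cechComparison {F : Sheaf (localSectionTopology G) AddCommGrpCat.{u + 1}} {n : ℕ}
    (c : F.obj.obj (op (power G n))) (hc : cechD F.obj n c = 0) : F.H n :=
  (powerNerve G).comparison (pointIsTerminal G) powerNerve_covering c hc

/-- The relation `Represents`, on cocycles, is the graph of the canonical map. -/
lemma represents_iff (n : ℕ) : ∀ (F : Sheaf (localSectionTopology G) AddCommGrpCat.{u + 1})
    (c : F.obj.obj (op (power G n))) (hc : cechD F.obj n c = 0) (x : F.H n),
    Represents n F c x ↔ cechComparison c hc = x := by
  induction n with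
  | zero =>
    intro F c hc x
    exact ((powerNerve G).comparison_zero_iff (pointIsTerminal G) powerNerve_covering c hc x).symm
  | succ n ih =>
    intro F c hc x
    constructor
    · rintro ⟨E, Q, i, q, w, hS, b, y, hb, hy, rfl⟩
      have hqb := (powerNerve G).coboundary_image w c b hb
      obtain rfl := (ih Q _ hqb y).1 hy
      exact (powerNerve G).comparison_succ (pointIsTerminal G) powerNerve_covering hS c hc b hb hqb
    · rintro rfl
      obtain ⟨E, Q, i, q, w, hS, b, hb⟩ := (powerNerve G).exists_shortExact_comparison c hc
      have hqb := (powerNerve G).coboundary_image w c b hb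
      exact ⟨E, Q, i, q, w, hS, b, cechComparison _ hqb, hb, (ih Q _ hqb _).2 rfl,
        (powerNerve G).comparison_succ (pointIsTerminal G) powerNerve_covering hS c hc b hb hqb⟩

/-- If `ℝ̃` has no higher cohomology on the powers of `G`, the canonical map is an isomorphism. -/
theorem exists_contCohomology_equiv (hF : ∀ (n m : ℕ) (x : Ext ((freeSheaf (localSectionTopology G)).obj (power G n))
      (realSheaf G) (m + 1)), x = 0) (p : ℕ) :
    ∃ e : GSpace.ContCohomology G p ≃+ (GSpace.realSheaf G).H p,
      ∀ (z : GSpace.homogeneousCocycles G p) (x : (GSpace.realSheaf G).H p),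
        e (QuotientAddGroup.mk z) = x ↔
          GSpace.Represents p (GSpace.realSheaf G) (GSpace.toCechCochain p z.1) x := by
  have hz (z : homogeneousCocycles G p) :
      cechD (realSheaf G).obj p (toCechCochain p z.1) = 0 := by
    rw [cechD_toCechCochain, (AddMonoidHom.mem_ker).1 z.2, map_zero]
  let Φ : homogeneousCocycles G p →+ (realSheaf G).H p :=
    AddMonoidHom.mk' (fun z => cechComparison _ (hz z)) fun z z' =>
      (powerNerve G).comparison_add (pointIsTerminal G) powerNerve_covering _ _ (hz z) (hz z')
        (hz (z + z'))
  have hsurj : Function.Surjective Φ := by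
    intro x
    obtain ⟨c, hc, rfl⟩ := (powerNerve G).comparison_surjective (pointIsTerminal G)
      powerNerve_covering hF p x
    obtain ⟨f, rfl⟩ := (toCechCochain p).surjective c
    refine ⟨⟨f, ?_⟩, rfl⟩
    have h : cechD (realSheaf G).obj p (toCechCochain p f) = 0 := hc
    rw [cechD_toCechCochain, map_eq_zero_iff _ (toCechCochain _).injective] at h
    exact h
  have hker : (homogeneousCoboundaries G p).addSubgroupOf (homogeneousCocycles G p) = Φ.ker := by
    ext z
    rw [AddSubgroup.mem_addSubgroupOf, AddMonoidHom.mem_ker]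
    cases p with
    | zero =>
      change z.1 = 0 ↔ cechComparison _ (hz z) = 0
      rw [← represents_iff, ← map_eq_zero_iff _ (toCechCochain 0).injective]
      change _ ↔ ((realSheaf G).obj.map (toPoint (power G 0)).op).hom
        (Sheaf.H.equiv₀ (realSheaf G) (pointIsTerminal G) 0) = _
      rw [map_zero, map_zero, eq_comm]
    | succ p =>
      change (∃ b, homogeneousD p b = z.1) ↔ cechComparison _ (hz z) = 0
      constructor
      · rintro ⟨b, hb⟩
        have h := (powerNerve G).comparison_coboundary (pointIsTerminal G) powerNerve_covering p
          (F := realSheaf G) (toCechCochain p b)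
        have e : (powerNerve G).coboundary (realSheaf G).obj p (toCechCochain p b) =
          toCechCochain (p + 1) z.1 := by
          rw [← hb]
          exact cechD_toCechCochain p b
        simp only [e] at h
        exact h
      · intro h
        obtain ⟨b, hb⟩ := (powerNerve G).exists_coboundary_of_comparison_eq_zero
          (pointIsTerminal G) powerNerve_covering hF p _ (hz z) h
        obtain ⟨b, rfl⟩ := (toCechCochain p).surjective b
        refine ⟨b, (toCechCochain (p + 1)).injective ?_⟩
        rw [← cechD_toCechCochain]
        exact hb
  refine ⟨(QuotientAddGroup.quotientAddEquivOfEq hker).trans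
    (QuotientAddGroup.quotientKerEquivOfSurjective Φ hsurj), fun z x => ?_⟩
  rw [represents_iff p _ _ (hz z)]
  rfl
end GSpace

/-! ### Induced `G`-spaces and nerves of closed covers -/

instance ParacompactSpace.prod_of_discreteTopology {D Y : Type*} [TopologicalSpace D] [DiscreteTopology D]
    [TopologicalSpace Y] [ParacompactSpace Y] : ParacompactSpace (D × Y) where
  locallyFinite_refinement α s ho hu := by
    choose v hvo hvu hvf hvs using fun d : D => precise_refinement (fun a => Prod.mk d ⁻¹' s a)
      (fun a => (ho a).preimage (by fun_prop)) (by
        rw [← Set.preimage_iUnion, hu, Set.preimage_univ])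
    refine ⟨α, fun a => {p | p.2 ∈ v p.1 a}, fun a => ?_, ?_, fun p => ?_, fun a =>
      ⟨a, fun p hp => hvs p.1 a hp⟩⟩
    · rw [isOpen_prod_iff]
      intro d y h
      exact ⟨{d}, v d a, isOpen_discrete _, hvo d a, rfl, h, by rintro ⟨_, y'⟩ ⟨rfl, h'⟩; exact h'⟩
    · refine Set.eq_univ_of_forall fun p => ?_
      have : p.2 ∈ ⋃ a, v p.1 a := by rw [hvu]; trivial
      simpa using this
    · obtain ⟨t, ht, hf⟩ := hvf p.1 p.2
      refine ⟨{p.1} ×ˢ t, prod_mem_nhds (by simp) ht, hf.subset ?_⟩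
      rintro a ⟨⟨d, y⟩, h, rfl, h'⟩
      exact ⟨y, h, h'⟩

section
variable {Y ι : Type u} [TopologicalSpace Y] [TopologicalSpace ι]

/-- The disjoint union of the `(n + 1)`-fold intersections of members of the family `A`. It is encoded
as a subspace of `ι^{n+1} × Y`, where `ι` is meant to be discrete. -/
abbrev CoverNerveSpace (A : ι → Set Y) (n : ℕ) : Type u :=
  {p : (Fin (n + 1) → ι) × Y // ∀ k, p.2 ∈ A (p.1 k)}

variable [DiscreteTopology ι]
lemma isClosed_coverNerveSpace {A : ι → Set Y} (hA : ∀ i, IsClosed (A i)) (n : ℕ) :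
    IsClosed {p : (Fin (n + 1) → ι) × Y | ∀ k, p.2 ∈ A (p.1 k)} := by
  have : {p : (Fin (n + 1) → ι) × Y | ∀ k, p.2 ∈ A (p.1 k)} =
      ⋂ (k) (i : ι), {p : (Fin (n + 1) → ι) × Y | p.1 k ∈ ({i}ᶜ : Set ι)} ∪ {p | p.2 ∈ A i} := by
    ext p
    simp only [Set.mem_ofPred_eq, Set.mem_iInter, Set.mem_union, Set.mem_compl_iff,
      Set.mem_singleton_iff]
    exact ⟨fun h k i => by by_cases e : p.1 k = i; exacts [.inr (e ▸ h k), .inl e],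
      fun h k => (h k (p.1 k)).resolve_left (fun e => e rfl)⟩
  rw [this]
  refine isClosed_iInter fun k => isClosed_iInter fun i => IsClosed.union ?_ ?_
  · exact (isClosed_discrete _).preimage (by fun_prop : Continuous fun p : (Fin (n + 1) → ι) × Y => p.1 k)
  · exact (hA i).preimage continuous_snd

lemma paracompactSpace_coverNerveSpace [ParacompactSpace Y] {A : ι → Set Y}
    (hA : ∀ i, IsClosed (A i)) (n : ℕ) : ParacompactSpace (CoverNerveSpace A n) :=
  (isClosed_coverNerveSpace hA n).isClosedEmbedding_subtypeVal.paracompactSpace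
end

namespace GSpace
variable {G : Type u} [Group G] [TopologicalSpace G] [IsTopologicalGroup G]

/-- The action of `G` on `G × Y` by left translation of the first factor. -/
abbrev inducedMulAction (G Y : Type u) [Group G] : MulAction G (G × Y) where
  smul g p := (g * p.1, p.2)
  one_smul _ := Prod.ext (one_mul _) rfl
  mul_smul g k _ := Prod.ext (mul_assoc g k _) rfl

variable (G) in
/-- The `G`-space `G × Y` with `G` acting on the first factor only. -/
def induced (Y : Type u) [TopologicalSpace Y] : GSpace G where
  carrier := G × Y
  mulAction := inducedMulAction G Y
  continuousSMul := letI := inducedMulAction G Y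
    ⟨(continuous_fst.mul (continuous_fst.comp continuous_snd)).prodMk
      (continuous_snd.comp continuous_snd)⟩

section
variable {Y Y' : Type u} [TopologicalSpace Y] [TopologicalSpace Y']

/-- The morphism `id × f`. -/
def inducedMap (f : C(Y, Y')) : induced G Y ⟶ induced G Y' :=
  ⟨fun p => (p.1, f p.2), continuous_fst.prodMk (f.continuous.comp continuous_snd), fun _ _ => rfl⟩

/-- The equivariant extension `(g, y) ↦ g • f y` of a continuous map `f : Y → X`. -/
def ofInduced {X : GSpace G} (f : C(Y, X)) : induced G Y ⟶ X :=
  ⟨fun p => p.1 • f p.2, continuous_fst.smul (f.continuous.comp continuous_snd),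
    fun g p => mul_smul g p.1 (f p.2)⟩
end

section
variable {Y ι : Type u} [TopologicalSpace Y] [TopologicalSpace ι]

variable (G) in
/-- The Čech nerve of `G × ∐ᵢ Aᵢ ⟶ G × Y`. -/
noncomputable def coverNerve (A : ι → Set Y) : CechNerve (induced G Y) where
  obj n := induced G (CoverNerveSpace A n)
  aug := inducedMap ⟨fun p => p.1.2, by fun_prop⟩
  proj _ i := inducedMap ⟨fun p => ⟨(fun _ => p.1.1 i, p.1.2), fun _ => p.2 i⟩, by fun_prop⟩
  face _ i := inducedMap ⟨fun p => ⟨(fun j => p.1.1 (i.succAbove j), p.1.2), fun _ => p.2 _⟩,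
    by fun_prop⟩
  proj_zero := hom_ext fun p => Prod.ext rfl (Subtype.ext (Prod.ext
    (funext fun j => congrArg p.2.1.1 (Subsingleton.elim (0 : Fin 1) j)) rfl))
  proj_aug _ _ _ := rfl
  face_proj _ _ _ := rfl
  exists_lift {T} n t ht := by
    have h (i) (x : T) : (fn (t i) x).1 = (fn (t 0) x).1 ∧
        (fn (t i) x).2.1.2 = (fn (t 0) x).2.1.2 := by
      have := congrArg (fun k => fn k x) (ht i 0)
      exact ⟨congrArg (fun p => p.1) this, congrArg (fun p => p.2) this⟩
    have hc (i) : Continuous (fun x => (fn (t i) x : G × CoverNerveSpace A 0)) := continuous_fn (t i)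
    refine ⟨⟨fun x => ((fn (t 0) x).1, ⟨(fun i => (fn (t i) x).2.1.1 0, (fn (t 0) x).2.1.2),
      fun k => by rw [← (h k x).2]; exact (fn (t k) x).2.2 0⟩), ?_, fun g x => ?_⟩, fun i => ?_⟩
    · refine Continuous.prodMk (by fun_prop) (Continuous.subtype_mk (Continuous.prodMk ?_ ?_) _)
      · refine continuous_pi fun i => ?_
        have := hc i
        fun_prop
      · have := hc 0
        fun_prop
    · have e (i) : fn (t i) (g • x) = (g * (fn (t i) x).1, (fn (t i) x).2) := fn_smul (t i) g x
      refine Prod.ext ?_ (Subtype.ext (Prod.ext (funext fun i => ?_) ?_))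
      · exact congrArg (fun p => p.1) (e 0)
      · exact congrArg (fun p => p.2.1.1 0) (e i)
      · exact congrArg (fun p => p.2.1.2) (e 0)
    · refine hom_ext fun x => Prod.ext (h i x).1.symm (Subtype.ext (Prod.ext (funext fun j => ?_) (h i x).2.symm))
      exact congrArg (fn (t i) x).2.1.1 (Subsingleton.elim (0 : Fin 1) j)
  hom_ext {T n f g} h := by
    have h' (i : Fin (n + 1)) (x : T) := congrArg (fun k => fn k x) (h i)
    refine hom_ext fun x => Prod.ext ?_ (Subtype.ext (Prod.ext (funext fun i => ?_) ?_))
    · exact congrArg (fun p => p.1) (h' 0 x)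
    · exact congrArg (fun p => p.2.1.1 0) (h' i x)
    · exact congrArg (fun p => p.2.1.2) (h' 0 x)

variable (G) in
/-- The nerves of closed covers of paracompact `R₁` spaces that carry a partition of unity supported
in the interiors. -/
inductive PartitionNerve : ∀ ⦃X : GSpace G⦄, CechNerve X → Prop
  | mk {Y ι : Type u} [TopologicalSpace Y] [ParacompactSpace Y] [R1Space Y] [TopologicalSpace ι]
      [DiscreteTopology ι] (A : ι → Set Y) (hA : ∀ i, IsClosed (A i)) (ρ : PartitionOfUnity ι Y)
      (hρ : ρ.IsSubordinate fun i => interior (A i)) : PartitionNerve (coverNerve G A)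

variable (G) in
/-- The `G`-spaces of the form `G × Y` with `Y` a paracompact `R₁` space. -/
def IsInducedParacompact (X : GSpace G) : Prop :=
  ∃ (Y : Type u) (_ : TopologicalSpace Y), ParacompactSpace Y ∧ R1Space Y ∧ X = induced G Y

lemma PartitionNerve.isInducedParacompact ⦃X : GSpace G⦄ (N : CechNerve X) (hN : PartitionNerve G N) (n : ℕ) :
    IsInducedParacompact G (N.obj n) := by
  cases hN with
  | mk A hA ρ hρ =>
    exact ⟨_, _, paracompactSpace_coverNerveSpace hA n, inferInstance, rfl⟩

lemma PartitionNerve.covering ⦃X : GSpace G⦄ (N : CechNerve X) (hN : PartitionNerve G N) :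
    Sieve.generate (Presieve.singleton N.aug) ∈ localSectionTopology G X := by
  cases hN with
  | @mk Y ι _ _ _ _ _ A hA ρ hρ =>
    intro p
    obtain ⟨i, hi⟩ := ρ.exists_pos (Set.mem_univ (p : G × Y).2)
    refine ⟨{p : G × Y | 0 < ρ i p.2}, _, (coverNerve G A).aug,
      ⟨fun p => ((p.1 : G × Y).1, ⟨(fun _ => i, (p.1 : G × Y).2), fun _ => interior_subset (hρ i
        (subset_tsupport _ (ne_of_gt p.2)))⟩), ?_⟩, ?_, hi,
      ⟨_, 𝟙 _, _, Presieve.singleton_self _, Category.id_comp _⟩, fun _ => rfl⟩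
    · have : Continuous (fun p : {p : G × Y | 0 < ρ i p.2} => p.1) := continuous_subtype_val
      exact this.fst.prodMk (Continuous.subtype_mk (continuous_const.prodMk this.snd) _)
    · exact isOpen_lt continuous_const ((ρ i).continuous.comp continuous_snd)
end
end GSpace

/-! ### Vanishing of the cohomology of the powers of `G` -/

/-- An open cover indexed by the points is refined by a closed cover carrying a partition of unity
supported in the interiors. -/
lemma exists_partitionOfUnity_closed {Y : Type u} [TopologicalSpace Y] [ParacompactSpace Y] [R1Space Y]
    (U : Y → Set Y) (hU : ∀ y, IsOpen (U y)) (hmem : ∀ y, y ∈ U y) :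
    ∃ (ι : Type u) (A : ι → Set Y) (y : ι → Y)
      (ρ : PartitionOfUnity ι Y), (∀ i, IsClosed (A i)) ∧
        (ρ.IsSubordinate fun i => interior (A i)) ∧ ∀ i, A i ⊆ U (y i) := by
  obtain ⟨v, hvo, hvu, hvf, hvs⟩ := precise_refinement U hU
    (Set.eq_univ_of_forall fun y => Set.mem_iUnion.2 ⟨y, hmem y⟩)
  obtain ⟨w, hwu, hwo, hws⟩ := exists_iUnion_eq_closure_subset hvo hvf.point_finite hvu
  obtain ⟨ρ, hρ⟩ := PartitionOfUnity.exists_isSubordinate isClosed_univ w hwo hwu.ge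
  exact ⟨Y, fun i => closure (w i), id, ρ, fun _ => isClosed_closure,
    fun i => (hρ i).trans (interior_maximal subset_closure (hwo i)), fun i => (hws i).trans (hvs i)⟩

lemma paracompactSpace_pi_of_homeomorph {G K M : Type*} [TopologicalSpace G] [TopologicalSpace K]
    [CompactSpace K] [TopologicalSpace M] [TopologicalSpace.MetrizableSpace M]
    (h : G ≃ₜ K × M) (ι : Type*) [Finite ι] : ParacompactSpace (ι → G) := by
  have := Fintype.ofFinite ι
  let e : (ι → G) ≃ₜ (ι → K) × (ι → M) := (Homeomorph.piCongrRight fun _ => h).trans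
    { Equiv.arrowProdEquivProdArrow ι (fun _ => K) (fun _ => M) with
      continuous_toFun := by
        refine Continuous.prodMk (continuous_pi fun i => ?_) (continuous_pi fun i => ?_)
        · exact (continuous_apply i).fst
        · exact (continuous_apply i).snd
      continuous_invFun := continuous_pi fun i =>
        ((continuous_apply i).comp continuous_fst).prodMk ((continuous_apply i).comp continuous_snd) }
  let := TopologicalSpace.metrizableSpaceMetric M
  exact e.paracompactSpace_iff.2 inferInstance

namespace GSpace
variable {G : Type u} [Group G] [TopologicalSpace G] [IsTopologicalGroup G]

variable (G) in
/-- The isomorphism `(g₀, …, gₙ) ↦ (g₀, (g₀⁻¹ g₁, …, g₀⁻¹ gₙ))` of `G`-spaces. -/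
def powerIso (n : ℕ) : power G n ≅ induced G (Fin n → G) where
  hom := ⟨fun x => (x 0, fun k => (x 0)⁻¹ * x k.succ), by
      have (i : Fin (n + 1)) : Continuous fun x : Fin (n + 1) → G => x i := continuous_apply i
      exact (this 0).prodMk (continuous_pi fun k => (this 0).inv.mul (this k.succ)),
    fun g x => Prod.ext rfl (funext fun k => by
      change (g * x 0)⁻¹ * (g * x k.succ) = (x 0)⁻¹ * x k.succ
      group)⟩
  inv := ⟨fun p => Fin.cons (α := fun _ => G) p.1 fun k => p.1 * p.2 k, by
      refine continuous_pi fun i => ?_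
      cases i using Fin.cases with
      | zero => exact continuous_fst
      | succ k => exact continuous_fst.mul ((continuous_apply k).comp continuous_snd),
    fun g p => funext fun i => by
      cases i using Fin.cases with
      | zero => rfl
      | succ k => exact mul_assoc g p.1 (p.2 k)⟩
  hom_inv_id := hom_ext fun x => funext fun i => by
    cases i using Fin.cases with
    | zero => rfl
    | succ k => exact mul_inv_cancel_left (x 0) (x k.succ)
  inv_hom_id := hom_ext fun p => Prod.ext rfl (funext fun k => inv_mul_cancel_left p.1 (p.2 k))

section
variable {Y ι : Type u} [TopologicalSpace Y] [TopologicalSpace ι] [DiscreteTopology ι]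

variable (G) in
/-- The inclusion of `G × Aᵢ` as a summand of `G × ∐ᵢ Aᵢ`. -/
def coverInclusion (A : ι → Set Y) (i : ι) : induced G (A i) ⟶ induced G (CoverNerveSpace A 0) :=
  inducedMap ⟨fun y => ⟨(fun _ => i, y.1), fun _ => y.2⟩, by fun_prop⟩

lemma coverInclusion_covering (A : ι → Set Y) :
    Sieve.generate (Presieve.ofArrows _ (coverInclusion G A)) ∈
      localSectionTopology G (induced G (CoverNerveSpace A 0)) := by
  intro p
  let i₀ : ι := (p : G × CoverNerveSpace A 0).2.1.1 0
  refine ⟨{p : G × CoverNerveSpace A 0 | p.2.1.1 0 = i₀}, _, coverInclusion G A i₀,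
    ⟨fun p => ((p.1 : G × CoverNerveSpace A 0).1, ⟨(p.1 : G × CoverNerveSpace A 0).2.1.2, by
      have := (p.1 : G × CoverNerveSpace A 0).2.2 0
      rwa [p.2] at this⟩), ?_⟩, ?_, rfl,
    ⟨_, 𝟙 _, _, Presieve.ofArrows.mk i₀, Category.id_comp _⟩, fun p => ?_⟩
  · have : Continuous (fun p : {p : G × CoverNerveSpace A 0 | p.2.1.1 0 = i₀} => p.1) :=
      continuous_subtype_val
    exact this.fst.prodMk (Continuous.subtype_mk (by fun_prop) _)
  · exact (isOpen_discrete {i₀}).preimage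
      (by fun_prop : Continuous fun p : G × CoverNerveSpace A 0 => p.2.1.1 0)
  · refine Prod.ext rfl (Subtype.ext (Prod.ext (funext fun j => ?_) rfl))
    exact p.2.symm.trans (congrArg (p.1 : G × CoverNerveSpace A 0).2.1.1 (Subsingleton.elim (0 : Fin 1) j))

/-- A sheaf takes the disjoint union of the `G × Aᵢ` to a product. -/
lemma exists_glue_coverInclusion (F : Sheaf (localSectionTopology G) AddCommGrpCat.{u + 1})
    (A : ι → Set Y) (t : ∀ i, F.obj.obj (op (induced G (A i)))) :
    ∃! s : F.obj.obj (op (induced G (CoverNerveSpace A 0))),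
      ∀ i, (F.obj.map (coverInclusion G A i).op).hom s = t i := by
  have h := (Presieve.isSheafFor_arrows_iff _ _).1
    (isSheafFor_of_generate_mem F (coverInclusion_covering (G := G) A))
  refine h t fun i j T gi gj hg => ?_
  have hg' (x : T) := congrArg (fun k => fn k x) hg
  by_cases hij : i = j
  · subst hij
    have : gi = gj := hom_ext fun x => Prod.ext (congrArg (fun p => p.1) (hg' x))
      (Subtype.ext (congrArg (fun p => p.2.1.2) (hg' x)))
    rw [this]
  · have : IsEmpty T := ⟨fun x => hij (congrArg (fun p => p.2.1.1 0) (hg' x))⟩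
    exact sections_eq_of_empty_cover F (fun x => isEmptyElim x) _ _
end

/-- Sections over `G × Y` lift along epimorphisms after passing to a closed cover of `Y` with a
partition of unity. A local section near `(1, y)` restricts to the slice `{1} × Y` and extends
equivariantly, so no equivariance of the local sections is needed. -/
lemma exists_partitionNerve_lift ⦃X : GSpace G⦄ (hX : IsInducedParacompact G X)
    {E Q : Sheaf (localSectionTopology G) AddCommGrpCat.{u + 1}} (q : E ⟶ Q) [Epi q]
    (s : Q.obj.obj (op X)) : ∃ N : CechNerve X, PartitionNerve G N ∧
      ∃ t : E.obj.obj (op (N.obj 0)), (q.hom.app _).hom t = (Q.obj.map N.aug.op).hom s := by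
  obtain ⟨Y, _, _, _, rfl⟩ := hX
  have hq : Sheaf.IsLocallySurjective q := (Sheaf.isLocallySurjective_iff_epi' _ q).2 inferInstance
  have hloc (y : Y) := hq.imageSieve_mem s (1, y)
  choose V W f σ hV hy hf hσ using hloc
  choose t ht using hf
  obtain ⟨ι, A, y, ρ, hA, hρ, hAU⟩ := exists_partitionOfUnity_closed
    (fun y => {y' : Y | ((1, y') : G × Y) ∈ V y}) (fun y => (hV y).preimage (by fun_prop)) hy
  let _ : TopologicalSpace ι := ⊥
  have : DiscreteTopology ι := ⟨rfl⟩
  let τ (i : ι) : C(A i, W (y i)) := (σ (y i)).comp ⟨fun a => ⟨((1, a.1) : G × Y), hAU i a.2⟩,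
    Continuous.subtype_mk (by fun_prop) _⟩
  have hτ (i : ι) : ofInduced (τ i) ≫ f (y i) = coverInclusion G A i ≫ (coverNerve G A).aug :=
    hom_ext fun p => by
      change fn (f (y i)) ((p : G × A i).1 • τ i (p : G × A i).2) = _
      rw [fn_smul]
      refine (congrArg _ (hσ (y i) _)).trans ?_
      exact Prod.ext (mul_one _) rfl
  obtain ⟨e, he, -⟩ := exists_glue_coverInclusion E A fun i =>
    (E.obj.map (ofInduced (τ i)).op).hom (t (y i))
  refine ⟨coverNerve G A, ⟨A, hA, ρ, hρ⟩, e, ?_⟩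
  refine (exists_glue_coverInclusion Q A fun i => (Q.obj.map (coverInclusion G A i).op).hom
    ((Q.obj.map (coverNerve G A).aug.op).hom s)).unique (fun i => ?_) fun _ => rfl
  refine (sheafHom_naturality q (coverInclusion G A i) e).symm.trans ?_
  rw [he]
  refine (sheafHom_naturality q (ofInduced (τ i)) (t (y i))).trans ?_
  refine (congrArg _ (ht (y i))).trans ((presheaf_map_map Q.obj _ _ s).trans ?_)
  rw [hτ]
  exact (presheaf_map_map Q.obj _ _ s).symm

lemma coboundary_realSheaf_apply {X : GSpace G} (N : CechNerve X) (n : ℕ)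
    (c : (realSheaf G).obj.obj (op (N.obj n))) (x : N.obj (n + 1)) :
    (N.coboundary (realSheaf G).obj n c).down.1 x =
      ∑ i : Fin (n + 2), (-1 : ℝ) ^ (i : ℕ) * c.down.1 (fn (N.face n i) x) := by
  let ev : (realSheaf G).obj.obj (op (N.obj (n + 1))) →+ ℝ :=
    { toFun := fun f => f.down.1 x, map_zero' := rfl, map_add' := fun _ _ => rfl }
  change ev (N.coboundary (realSheaf G).obj n c) = _
  rw [CechNerve.coboundary, AddMonoidHom.finsetSum_apply, map_sum]
  refine Finset.sum_congr rfl fun i _ => ?_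
  rw [AddMonoidHom.smul_apply, map_zsmul, zsmul_eq_mul]
  push_cast
  rfl

/-- The sheaf `ℝ̃` is Čech acyclic for closed covers with a partition of unity `ρ`, by the homotopy
`f ↦ ∑ⱼ ρⱼ f(j, –)`. -/
theorem realSheaf_isCechAcyclic ⦃X : GSpace G⦄ (N : CechNerve X) (hN : PartitionNerve G N) :
    N.IsCechAcyclic (realSheaf G) := by
  cases hN with
  | @mk Y ι _ _ _ _ _ A hA ρ hρ =>
  intro n c hc
  classical
  let f (z : CoverNerveSpace A (n + 1)) : ℝ := c.down.1 ((1, z) : G × CoverNerveSpace A (n + 1))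
  have hf : Continuous f := c.down.1.continuous.comp
    ((continuous_const.prodMk continuous_id : Continuous fun z => ((1, z) : G × CoverNerveSpace A (n + 1))))
  have hcf (g : G) (z : CoverNerveSpace A (n + 1)) :
      c.down.1 ((g, z) : G × CoverNerveSpace A (n + 1)) = f z := by
    have := c.down.2 g ((1, z) : G × CoverNerveSpace A (n + 1))
    refine Eq.trans (congrArg _ ?_) this
    exact Prod.ext (mul_one g).symm rfl
  let cons (m : ℕ) (j : ι) (z : CoverNerveSpace A m) (h : z.1.2 ∈ A j) : CoverNerveSpace A (m + 1) :=
    ⟨(Fin.cons j z.1.1, z.1.2), fun k => by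
      cases k using Fin.cases with
      | zero => exact h
      | succ k => exact z.2 k⟩
  let faceMap (m : ℕ) (i : Fin (m + 2)) (z : CoverNerveSpace A (m + 1)) : CoverNerveSpace A m :=
    ⟨(fun j => z.1.1 (i.succAbove j), z.1.2), fun _ => z.2 _⟩
  -- The `j`-th term of the homotopy, extended by zero to the intersections outside `A j`; it is
  -- continuous since `ρ j` is supported in the interior of `A j`.
  let F (j : ι) (z : CoverNerveSpace A n) : ℝ :=
    if h : z.1.2 ∈ A j then ρ j z.1.2 * f (cons n j z h) else 0
  have hFρ (j : ι) (z) (h : ρ j z.1.2 = 0) : F j z = 0 := by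
    simp only [F, h, zero_mul, dite_eq_ite, ite_self]
  have hFcont (j : ι) : Continuous (F j) := by
    refine continuous_of_tsupport fun z hz => ?_
    have hcl : tsupport (F j) ⊆ {z | z.1.2 ∈ tsupport (ρ j)} :=
      closure_minimal (fun z hz => subset_tsupport _ fun h => hz (hFρ j z h))
        ((isClosed_tsupport _).preimage (by fun_prop))
    have hO : IsOpen {z : CoverNerveSpace A n | z.1.2 ∈ interior (A j)} :=
      isOpen_interior.preimage (by fun_prop)
    refine ContinuousOn.continuousAt (s := {z | z.1.2 ∈ interior (A j)}) ?_
      (hO.mem_nhds (hρ j (hcl hz)))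
    rw [continuousOn_iff_continuous_domRestrict]
    have e : {z : CoverNerveSpace A n | z.1.2 ∈ interior (A j)}.domRestrict (F j) =
        fun z => ρ j z.1.1.2 * f (cons n j z.1 (interior_subset z.2)) :=
      funext fun z => dif_pos (interior_subset z.2)
    rw [e]
    refine ((ρ j).continuous.comp (by fun_prop)).mul (hf.comp (Continuous.subtype_mk
      (Continuous.prodMk (continuous_pi fun k => ?_) (by fun_prop)) _))
    cases k using Fin.cases with
    | zero => exact continuous_const
    | succ k => simp only [Fin.cons_succ]; fun_prop
  have hFlf : LocallyFinite fun j => Function.support (F j) :=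
    (ρ.locallyFinite.preimage_continuous (by fun_prop :
      Continuous fun z : CoverNerveSpace A n => z.1.2)).subset fun j z hz h => hz (hFρ j z h)
  let b : realMaps (induced G (CoverNerveSpace A n)) :=
    ⟨⟨fun p => ∑ᶠ j, F j (p : G × CoverNerveSpace A n).2,
      (continuous_finsum hFcont hFlf).comp continuous_snd⟩, fun _ _ => rfl⟩
  refine ⟨ULift.up b, ULift.ext _ _ (Subtype.ext (ContinuousMap.ext fun p => ?_))⟩
  obtain ⟨g, z⟩ := (p : G × CoverNerveSpace A (n + 1))
  have hb : ∀ w : CoverNerveSpace A n, w.1.2 = z.1.2 →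
      ∑ᶠ j, F j w = ∑ j ∈ ρ.finsupport z.1.2, F j w := fun w hw =>
    finsum_eq_sum_of_support_subset _ fun j hj =>
      (ρ.mem_finsupport _).2 fun h => hj (hFρ j w (hw ▸ h))
  -- The cocycle condition at the point with `j` prepended.
  have hcocycle (j : ι) (h : z.1.2 ∈ A j) :
      ∑ i : Fin (n + 2), (-1 : ℝ) ^ (i : ℕ) * f (cons n j (faceMap n i z) h) = f z := by
    have h1 := coboundary_realSheaf_apply (coverNerve G A) (n + 1) c
      ((1, cons (n + 1) j z h) : G × CoverNerveSpace A (n + 2))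
    rw [hc, Fin.sum_univ_succ] at h1
    have h2 : c.down.1 (fn ((coverNerve G A).face (n + 1) 0)
        ((1, cons (n + 1) j z h) : G × CoverNerveSpace A (n + 2))) = f z := rfl
    have h3 (i : Fin (n + 2)) : c.down.1 (fn ((coverNerve G A).face (n + 1) i.succ)
        ((1, cons (n + 1) j z h) : G × CoverNerveSpace A (n + 2))) =
          f (cons n j (faceMap n i z) h) := by
      refine congrArg f (Subtype.ext (Prod.ext (funext fun k => ?_) rfl))
      cases k using Fin.cases with
      | zero => rfl
      | succ k =>
        change (Fin.cons j z.1.1 : Fin (n + 3) → ι) (i.succ.succAbove k.succ) = _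
        rw [Fin.succ_succAbove_succ]
        rfl
    have h4 : (0 : ℝ) = f z + ∑ i : Fin (n + 2), (-1 : ℝ) ^ ((i : ℕ) + 1) *
        f (cons n j (faceMap n i z) h) := by
      refine Eq.trans h1 ?_
      rw [h2]
      simp only [h3, Fin.val_succ, Fin.val_zero, pow_zero, one_mul]
    simp only [pow_succ, mul_neg, mul_one, neg_mul, Finset.sum_neg_distrib] at h4
    linarith
  refine (coboundary_realSheaf_apply (coverNerve G A) n (ULift.up b) (g, z)).trans ?_
  rw [hcf]
  have e1 (i : Fin (n + 2)) : b.1 (fn ((coverNerve G A).face n i) (g, z)) =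
      ∑ j ∈ ρ.finsupport z.1.2, F j (faceMap n i z) := hb (faceMap n i z) rfl
  have e2 (j : ι) : ∑ i : Fin (n + 2), (-1 : ℝ) ^ (i : ℕ) * F j (faceMap n i z) =
      ρ j z.1.2 * f z := by
    by_cases h : z.1.2 ∈ A j
    · rw [← hcocycle j h, Finset.mul_sum]
      refine Finset.sum_congr rfl fun i _ => ?_
      have : F j (faceMap n i z) = ρ j z.1.2 * f (cons n j (faceMap n i z) h) := dif_pos h
      rw [this]
      ring
    · have h0 : ρ j z.1.2 = 0 := by
        by_contra h0
        exact h (interior_subset (hρ j (subset_tsupport _ h0)))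
      rw [h0, zero_mul]
      exact Finset.sum_eq_zero fun i _ => by rw [hFρ j (faceMap n i z) h0, mul_zero]
  calc _ = ∑ i : Fin (n + 2), (-1 : ℝ) ^ (i : ℕ) *
        ∑ j ∈ ρ.finsupport z.1.2, F j (faceMap n i z) :=
        Finset.sum_congr rfl fun i _ => congrArg _ (e1 i)
    _ = ∑ j ∈ ρ.finsupport z.1.2, ρ j z.1.2 * f z := by
        simp only [Finset.mul_sum]
        rw [Finset.sum_comm]
        exact Finset.sum_congr rfl fun j _ => e2 j
    _ = f z := by rw [← Finset.sum_mul, ρ.sum_finsupport (Set.mem_univ _), one_mul]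

theorem ext_power_realSheaf_eq_zero {K : Type*} [TopologicalSpace K] [CompactSpace K]
    {M : Type*} [TopologicalSpace M] [TopologicalSpace.MetrizableSpace M]
    (h : G ≃ₜ K × M) (n m : ℕ) (x : Ext ((freeSheaf (localSectionTopology G)).obj (power G n))
      (realSheaf G) (m + 1)) : x = 0 := by
  have := paracompactSpace_pi_of_homeomorph h (Fin n)
  let e := (freeSheaf (localSectionTopology G)).mapIso (powerIso G n)
  have h0 : (Ext.mk₀ e.inv).comp x (zero_add _) = 0 :=
    ext_eq_zero_of_cartan PartitionNerve.covering PartitionNerve.isInducedParacompact exists_partitionNerve_lift m _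
      realSheaf_isCechAcyclic _ ⟨Fin n → G, inferInstance, this, inferInstance, rfl⟩ _
  rw [← Ext.mk₀_id_comp x, ← e.hom_inv_id, ← Ext.mk₀_comp_mk₀_assoc, h0, Ext.comp_zero]

end GSpace

theorem corollary2p6 {G : Type u} [Group G] [TopologicalSpace G] [IsTopologicalGroup G]
    {K : Type*} [TopologicalSpace K] [CompactSpace K]
    {M : Type*} [TopologicalSpace M] [TopologicalSpace.MetrizableSpace M]
    (h : G ≃ₜ K × M) (p : ℕ) :
    ∃ e : GSpace.ContCohomology G p ≃+ (GSpace.realSheaf G).H p,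
      ∀ (z : GSpace.homogeneousCocycles G p) (x : (GSpace.realSheaf G).H p),
        e (QuotientAddGroup.mk z) = x ↔
          GSpace.Represents p (GSpace.realSheaf G) (GSpace.toCechCochain p z.1) x :=
  GSpace.exists_contCohomology_equiv (fun n m x => GSpace.ext_power_realSheaf_eq_zero h n m x) p
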